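/- Let $\gamma\subset\mathbb{R}^2$ be a regular dodecagon (a closed convex polygon with interior, of arbitrary size and position). The outer billiard map $T$ with table $\gamma$ is defined as follows: for a point $p\notin\gamma$, draw from $p$ the right tangent to $\gamma$, i.e. the ray from $p$ that meets $\gamma$ and has $\gamma$ on its left side; if this ray meets $\gamma$ in exactly one point $v$, then $T(p)=2v-p$ is the point symmetric to $p$ with respect to $v$; otherwise $T(p)$ is undefined. A point $p\notin\gamma$ is called periodic if there is an integer $n\ge 1$ such that $T^n(p)$ is defined and $T^n(p)=p$. **Theorem 2.** For the outer billiard outside a regular dodecagon $\gamma$, the periodic points form a set of full Lebesgue measure in the complement of the table: the set of points $p\in\mathbb{R}^2\setminus\gamma$ that are not periodic has Lebesgue measure $0$. -/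

import Mathlib

/-!
Outer billiards in the plane, which is identified with the complex numbers.
-/

namespace OuterBilliard

/-- The oriented area of the parallelogram spanned by the plane vectors `a` and `b`. It is
positive exactly when `b` points strictly to the left of `a`. -/
def cross (a b : ℂ) : ℝ := a.re * b.im - a.im * b.re

/-- The point `v` is the (unique) point where the right tangent from `p` touches the figure `γ`:
`v` belongs to `γ`, and all the other points of `γ` lie strictly to the left of the ray that
starts at `p` and passes through `v`. -/
def IsRightTangencyPoint (γ : Set ℂ) (p v : ℂ) : Prop :=
  v ∈ γ ∧ ∀ w ∈ γ, w ≠ v → 0 < cross (v - p) (w - p)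

theorem IsRightTangencyPoint.unique {γ : Set ℂ} {p v v' : ℂ}
    (h : IsRightTangencyPoint γ p v) (h' : IsRightTangencyPoint γ p v') : v = v' := by
  by_contra hne
  have h1 := h.2 v' h'.1 (Ne.symm hne)
  have h2 := h'.2 v h.1 hne
  unfold cross at h1 h2
  linarith

/-- The outer billiard map with table `γ`, as a partial map of the plane. It is defined at those
points `p` outside `γ` whose right tangent to `γ` touches `γ` at exactly one point `v`, and it
sends `p` to the point symmetric to `p` with respect to `v`. -/
noncomputable def outerBilliard (γ : Set ℂ) : ℂ → Part ℂ := fun p =>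
  ⟨p ∉ γ ∧ ∃ v, IsRightTangencyPoint γ p v, fun h => 2 * h.2.choose - p⟩

theorem mem_outerBilliard {γ : Set ℂ} {p q : ℂ} :
    q ∈ outerBilliard γ p ↔ p ∉ γ ∧ ∃ v, IsRightTangencyPoint γ p v ∧ q = 2 * v - p := by
  constructor
  · rintro ⟨h, rfl⟩
    exact ⟨h.1, h.2.choose, h.2.choose_spec, rfl⟩
  · rintro ⟨hp, v, hv, rfl⟩
    refine ⟨⟨hp, v, hv⟩, ?_⟩
    have e := (Exists.choose_spec (⟨v, hv⟩ : ∃ v, IsRightTangencyPoint γ p v)).unique hv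
    change 2 * Exists.choose _ - p = 2 * v - p
    rw [e]

/-- The `n`-th iterate of a partial map; it is defined at `p` when the map can be applied `n` times
in succession, starting from `p`. -/
def iter (T : ℂ → Part ℂ) : ℕ → ℂ → Part ℂ
  | 0, p => Part.some p
  | n + 1, p => (iter T n p).bind T

/-- The point `p` is periodic for the outer billiard with table `γ`: for some `n ≥ 1` the `n`-th
iterate of the map is defined at `p` and equal to `p`. (Such a point lies outside `γ`.) -/
def IsPeriodic (γ : Set ℂ) (p : ℂ) : Prop :=
  ∃ n : ℕ, 0 < n ∧ p ∈ iter (outerBilliard γ) n p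

/-- The closed regular dodecagon with center `c` and with `c + a` as one of its vertices. -/
noncomputable def regularDodecagon (c a : ℂ) : Set ℂ :=
  convexHull ℝ (Set.range fun k : Fin 12 =>
    c + a * Complex.exp (2 * Real.pi * Complex.I * (k : ℕ) / 12))

end OuterBilliard

/-! Normalise the table to centre `0` and apothem `1` and write `ζ` for `rt`. Everything is done up
to rotations by powers of `ζ`, which commute with the billiard map. On the wedge of points reflected
in `vert`, the map is a half-turn composed with the translation by `-2 * vert`. Iterating it brings
generic outside points to the strip |Im z| < 1. This strip is divided into rhombic cells centred at
`4 * n`, and a return to the strip rotates each cell by π/6 about its centre (`step_iterate_cell`).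

For `n ≥ 1` the copy of the table inscribed in a cell is invariant under this rotation, so its
points have finite orbits (`finiteOrbit_disc`). What remains are the corners of the cells. Facing
corners of neighbouring cells are exchanged by a half-turn about `4 * n + 2`, and all of them carry
the same dynamics: the map `hornMap` of one bounded region `Horn`, independent of `n`
(`step_iterate_strip`).

The horn is self-similar under `shrink`, the contraction by `ratio = (2 - √3)²` towards its tip. Two
facts carry the argument. A generic orbit in the horn is finite or enters the scaled horn within 88
steps (`enter_shrink`). If an orbit is finite, so is that of the scaled point
(`FiniteOrbit.shrink`), because the orbit of a scaled point returns to the scaled orbit of the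
original one (`scaledReturn`). Hence points with infinite orbits enter the scaled copy of their own
set. Since `hornMap` does not increase the area of preimages, that set `W` satisfies |W| ≤ 89
`ratio`² |W|, with 89 `ratio`² < 1 and |W| finite, so |W| = 0 (`volume_wandering`). The infinite
orbits in the plane come from countably many congruent copies of `W`, and injectivity turns finite
orbits into periodic ones.

Both facts about the horn rest on finite exact computations (`run`). On each piece of a polygon an
iterate is `z ↦ ζ^s z + t` with `t ∈ ℤ[ζ]`, and every cut is perpendicular to one of twelve
directions, with offset in `ℤ[√3]`. Points with no component in `ℚ(√3)` never meet a discontinuity,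
and the others form a null set. -/

namespace OuterBilliard

/-! ### Exact arithmetic and the computation on polygons -/

/-- The number `a + b √3`. -/
structure Surd where
  a : Int
  b : Int

namespace Surd

/-- When the signs differ, `a` and `b √3` are compared through the squares `a²` and `3 b²`. -/
def nonneg : Int → Int → Bool
  | .ofNat _, .ofNat _ => true
  | .ofNat m, .negSucc n => Nat.ble (3 * ((n + 1) * (n + 1))) (m * m)
  | .negSucc m, .ofNat n => Nat.ble ((m + 1) * (m + 1)) (3 * (n * n))
  | .negSucc _, .negSucc _ => false

def le (x y : Surd) : Bool := nonneg (Int.sub y.a x.a) (Int.sub y.b x.b)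

def add (x y : Surd) : Surd := ⟨Int.add x.a y.a, Int.add x.b y.b⟩

def sub (x y : Surd) : Surd := ⟨Int.sub x.a y.a, Int.sub x.b y.b⟩

def neg (x : Surd) : Surd := ⟨Int.neg x.a, Int.neg x.b⟩

def twice (x : Surd) : Surd := x.add x

def sqrtThreeMul (x : Surd) : Surd := ⟨Int.mul 3 x.b, x.a⟩

end Surd

open Surd

def comboLe (f g : Surd → Surd) (x y : Option Surd) (c : Surd) : Bool :=
  match x, y with
  | some x, some y => Surd.le (Surd.add (f x) (g y)) c
  | _, _ => false

def boundLe (x : Option Surd) (c : Surd) : Bool :=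
  match x with
  | some x => Surd.le x c
  | none => false

/-- Bounds on the twelve support functionals, the first of which has to be bounded by `c`. -/
def headLe (l : List (Option Surd)) (c : Surd) : Bool :=
  match l with
  | [b0, b1, b2, b3, b4, _, _, _, b8, b9, b10, b11] =>
    -- Direction `0` is a positive combination of one direction on each side of it when the two are
    -- less than π apart, for instance `√3 h₀ = h₁₁ + h₁`. The ten such pairs are tried; for a
    -- nonempty polygon these tests are exhaustive by linear programming duality.
    boundLe b0 c || (comboLe id id b11 b1 (sqrtThreeMul c) || (
    comboLe sqrtThreeMul id b11 b2 (twice c) || (comboLe id sqrtThreeMul b10 b1 (twice c) || (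
    comboLe twice id b11 b3 (sqrtThreeMul c) || (comboLe id twice b9 b1 (sqrtThreeMul c) || (
    comboLe sqrtThreeMul id b11 b4 c || (comboLe id sqrtThreeMul b8 b1 c || (
    comboLe id id b10 b2 c || (
    comboLe twice sqrtThreeMul b10 b3 c || comboLe sqrtThreeMul twice b9 b2 c)))))))))
  | _ => false

/-- The bounds in `l` force the `k`-th functional to be at most `c`. -/
def implies (l : List (Option Surd)) (k : Nat) (c : Surd) : Bool :=
  headLe (l.drop k ++ l.take k) c

/-- Redundant bounds among the first `i` are dropped. -/
def prune : Nat → List (Option Surd) → List (Option Surd)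
  | 0, l => l
  | i + 1, l =>
    prune i (match l.drop i with
      | some c :: _ => cond (implies (l.set i none) i c) (l.set i none) l
      | _ => l)

/-- The bound `c` on the `k`-th functional is added to `l`. -/
def cut (l : List (Option Surd)) (k : Nat) (c : Surd) : List (Option Surd) :=
  prune 12 (l.set k (some c))

/-- The element `a + b ζ + c ζ² + d ζ³` of the ring generated by the twelfth root of unity. -/
structure Cyc where
  a : Int
  b : Int
  c : Int
  d : Int

namespace Cyc

def rot (t : Cyc) : Cyc := ⟨Int.neg t.d, t.a, Int.add t.b t.d, t.c⟩

def flip (t : Cyc) : Cyc := ⟨Int.add 4 t.d, Int.neg t.a, Int.neg (Int.add t.b t.d), Int.neg t.c⟩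

end Cyc

/-- Follows the horn map for at most `n` steps on the polygon with the bounds `l`, on which the
iterate so far is the rotation by `s π / 6` followed by the translation by `t`. The polygon is cut
along the discontinuity until `goal` holds on every part. -/
def run (goal : List (Option Surd) → Nat → Cyc → Bool) :
    Nat → List (Option Surd) → Nat → Cyc → Bool
  | 0, l, s, t => goal l s t
  | n + 1, l, s, t => goal l s t ||
    -- Here `11 * s` stands for `-s` modulo 12. The discontinuity `ht 1 = 1` of the iterate pulls
    -- back to the line on which twice the component `k = 1 - s` equals `c = 2 - 2 * ht 1 t`; `k'`
    -- is the opposite direction.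
    (let c : Surd := ⟨Int.sub 2 (Int.add (Int.add t.b t.b) t.d), Int.neg (Int.add t.a t.c)⟩
     let k := (13 + 11 * s) % 12
     let k' := (19 + 11 * s) % 12
     cond (implies l k c) (run goal n l ((s + 1) % 12) t.rot)
      (cond (implies l k' c.neg) (run goal n l ((s + 7) % 12) t.flip)
        (run goal n (cut l k c) ((s + 1) % 12) t.rot &&
          run goal n (cut l k' c.neg) ((s + 7) % 12) t.flip)))

def sameInt : Int → Int → Bool
  | .ofNat m, .ofNat n => Nat.beq m n
  | .negSucc m, .negSucc n => Nat.beq m n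
  | _, _ => false

/-- The iterate is the rotation by `s' π / 6` followed by the translation by `t'`. -/
def goalMap (s' : Nat) (t' : Cyc) (s : Nat) (t : Cyc) : Bool :=
  Nat.beq s s' && (sameInt t.a t'.a && (sameInt t.b t'.b && (sameInt t.c t'.c && sameInt t.d t'.d)))

/-- The iterate lies in the scaled horn, or it is the identity. -/
def goalDeep (l : List (Option Surd)) (s : Nat) (t : Cyc) : Bool :=
  -- The inequality says that the iterate has `ht 0 ≥ 7 - 2 √3`.
  implies l ((6 + 11 * s) % 12)
    ⟨Int.sub (Int.add (Int.add t.a t.a) t.c) 14, Int.add t.b 4⟩ || goalMap 0 ⟨0, 0, 0, 0⟩ s t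

def goalMapOr (s' : Nat) (t' : Cyc) (_ : List (Option Surd)) (s : Nat) (t : Cyc) : Bool :=
  goalMap s' t' s t || goalMap 0 ⟨0, 0, 0, 0⟩ s t

/-- The bounds describe the triangle of the horn where `ht 1 ≥ 1`; the initial data `7`, `4` record
the first step `z ↦ 4 - ζ z`, since `ζ⁷ = -ζ`. -/
theorem run_deep : run goalDeep 84
    [none, none, some ⟨2, 0⟩, none, none, none, none, some ⟨-2, 0⟩, none, some ⟨2, 0⟩, none, none]
    7 ⟨4, 0, 0, 0⟩ = true := by decide +kernel
-- Components in the twelve directions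
/-- The primitive twelfth root of unity. -/
noncomputable def rt : ℂ := ⟨√3 / 2, 1 / 2⟩

/-- The component of `z` in the direction of the angle `k π / 6`. -/
noncomputable def ht (k : ℕ) (z : ℂ) : ℝ := ((starRingEnd ℂ rt) ^ k * z).re

theorem sq_sqrt_three : √3 * √3 = (3 : ℝ) := Real.mul_self_sqrt (by norm_num)

theorem sqrt_three_gt : (1.732 : ℝ) < √3 := Real.lt_sqrt_of_sq_lt (by norm_num)

theorem sqrt_three_lt : √3 < (1.7321 : ℝ) := (Real.sqrt_lt' (by norm_num)).2 (by norm_num)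

theorem sqrt_three_mul_rt : (√3 : ℂ) * rt = rt ^ 2 + 1 := by
  have h := sq_sqrt_three
  apply Complex.ext <;> simp [rt, pow_two] <;> linarith

theorem conj_rt_mul_rt : starRingEnd ℂ rt * rt = 1 := by
  have h := sq_sqrt_three
  apply Complex.ext <;> simp [rt] <;> linarith

theorem rt_sq : rt ^ 2 = ⟨1 / 2, √3 / 2⟩ := by
  have h := sq_sqrt_three
  apply Complex.ext <;> simp [rt, pow_two]
  · linarith
  · ring

theorem rt_pow_three : rt ^ 3 = Complex.I := by
  have h := sq_sqrt_three
  rw [pow_succ, rt_sq]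
  apply Complex.ext <;> simp [rt] <;> linarith

theorem rt_pow_four : rt ^ 4 = rt ^ 2 - 1 := by
  have h := sq_sqrt_three
  rw [pow_succ, rt_pow_three, rt_sq]
  apply Complex.ext
  all_goals simp [rt]
  all_goals linarith

theorem rt_pow_six : rt ^ 6 = -1 := by
  rw [show rt ^ 6 = (rt ^ 3) ^ 2 by ring, rt_pow_three, Complex.I_sq]

theorem rt_pow_twelve : rt ^ 12 = 1 := by
  rw [show rt ^ 12 = (rt ^ 6) ^ 2 by ring, rt_pow_six]; norm_num

theorem rt_pow_mod (m : ℕ) : rt ^ (m % 12) = rt ^ m := by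
  conv_rhs => rw [← Nat.mod_add_div m 12, pow_add, pow_mul, rt_pow_twelve, one_pow, mul_one]

theorem ht_add (k : ℕ) (z w : ℂ) : ht k (z + w) = ht k z + ht k w := by
  simp [ht, mul_add]

theorem ht_neg (k : ℕ) (z : ℂ) : ht k (-z) = -ht k z := by simp [ht]

theorem ht_sub (k : ℕ) (z w : ℂ) : ht k (z - w) = ht k z - ht k w := by
  simp [ht, mul_sub]

theorem ht_real_mul (k : ℕ) (r : ℝ) (z : ℂ) : ht k (r * z) = r * ht k z := by
  rw [ht, show starRingEnd ℂ rt ^ k * (r * z) = r * (starRingEnd ℂ rt ^ k * z) by ring,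
    Complex.re_ofReal_mul, ht]

theorem ht_succ_rt_mul (k : ℕ) (z : ℂ) : ht (k + 1) (rt * z) = ht k z := by
  rw [ht, pow_succ, show starRingEnd ℂ rt ^ k * starRingEnd ℂ rt * (rt * z) =
    starRingEnd ℂ rt ^ k * (starRingEnd ℂ rt * rt) * z by ring, conj_rt_mul_rt, mul_one, ht]

theorem ht_add_six (k : ℕ) (z : ℂ) : ht (k + 6) z = -ht k z := by
  rw [ht, pow_add, ← map_pow _ rt 6, rt_pow_six]
  simp [ht]

theorem ht_add_twelve (k : ℕ) (z : ℂ) : ht (k + 12) z = ht k z := by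
  rw [show k + 12 = k + 6 + 6 by rfl, ht_add_six, ht_add_six, neg_neg]

theorem ht_mod (k : ℕ) (z : ℂ) : ht (k % 12) z = ht k z := by
  conv_rhs => rw [← Nat.mod_add_div k 12]
  generalize k / 12 = m
  induction m with
  | zero => rfl
  | succ m ih => rw [show k % 12 + 12 * (m + 1) = k % 12 + 12 * m + 12 by ring, ht_add_twelve, ih]

theorem ht_congr {k l : ℕ} (h : k % 12 = l % 12) (z : ℂ) : ht k z = ht l z := by
  rw [← ht_mod k, h, ht_mod]

theorem ht_add_rt_pow_mul (k s : ℕ) (z : ℂ) : ht (k + s) (rt ^ s * z) = ht k z := by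
  induction s with
  | zero => simp
  | succ s ih => rw [← add_assoc, pow_succ', mul_assoc, ht_succ_rt_mul, ih]

theorem ht_rt_pow_mul {k l s : ℕ} (h : (l + s) % 12 = k % 12) (z : ℂ) :
    ht k (rt ^ s * z) = ht l z := by
  rw [← ht_congr h, ht_add_rt_pow_mul]

theorem ht_rec (k : ℕ) (z : ℂ) : ht (k + 2) z = √3 * ht (k + 1) z - ht k z := by
  have e : (√3 : ℂ) * starRingEnd ℂ rt = starRingEnd ℂ rt ^ 2 + 1 := by
    have := congrArg (starRingEnd ℂ) sqrt_three_mul_rt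
    simpa using this
  rw [← ht_real_mul, eq_sub_iff_add_eq]
  unfold ht
  rw [← Complex.add_re, pow_add, pow_add, pow_one,
    show starRingEnd ℂ rt ^ k * starRingEnd ℂ rt * (√3 * z) =
      starRingEnd ℂ rt ^ k * (√3 * starRingEnd ℂ rt) * z by ring, e]
  congr 1
  ring

theorem ht_zero (z : ℂ) : ht 0 z = z.re := by simp [ht]

theorem ht_one (z : ℂ) : ht 1 z = (√3 * z.re + z.im) / 2 := by
  simp [ht, rt]; ring

/-- All the components of a point, expressed by two neighbouring ones. -/
theorem ht_all (k : ℕ) (z : ℂ) :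
    ht (k + 2) z = √3 * ht (k + 1) z - ht k z ∧
    ht (k + 3) z = 2 * ht (k + 1) z - √3 * ht k z ∧
    ht (k + 4) z = √3 * ht (k + 1) z - 2 * ht k z ∧
    ht (k + 5) z = ht (k + 1) z - √3 * ht k z ∧
    ht (k + 6) z = -ht k z ∧
    ht (k + 7) z = -ht (k + 1) z ∧
    ht (k + 8) z = ht k z - √3 * ht (k + 1) z ∧
    ht (k + 9) z = √3 * ht k z - 2 * ht (k + 1) z ∧
    ht (k + 10) z = 2 * ht k z - √3 * ht (k + 1) z ∧
    ht (k + 11) z = √3 * ht k z - ht (k + 1) z := by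
  have h2 := ht_rec k z
  have h3 := ht_rec (k + 1) z
  have h4 := ht_rec (k + 2) z
  have h5 := ht_rec (k + 3) z
  have h6 := ht_add_six k z
  have h7 := ht_add_six (k + 1) z
  have h8 := ht_add_six (k + 2) z
  have h9 := ht_add_six (k + 3) z
  have h10 := ht_add_six (k + 4) z
  have h11 := ht_add_six (k + 5) z
  simp only [add_assoc, Nat.reduceAdd] at *
  have h := sq_sqrt_three
  have e3 : ht (k + 3) z = 2 * ht (k + 1) z - √3 * ht k z := by
    rw [h3, h2]; linear_combination ht (k + 1) z * h
  have e4 : ht (k + 4) z = √3 * ht (k + 1) z - 2 * ht k z := by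
    rw [h4, e3, h2]; linear_combination -ht k z * h
  have e5 : ht (k + 5) z = ht (k + 1) z - √3 * ht k z := by
    rw [h5, e4, e3]; linear_combination ht (k + 1) z * h
  refine ⟨h2, e3, e4, e5, h6, h7, ?_, ?_, ?_, ?_⟩
  · rw [h8, h2]; ring
  · rw [h9, e3]; ring
  · rw [h10, e4]; ring
  · rw [h11, e5]; ring

/-! ### Generic points -/

/-- A point none of whose components lies in the field generated by `√3`. -/
def Generic (z : ℂ) : Prop := ∀ (k : ℕ) (a b : ℚ), ht k z ≠ a + b * √3

/-- A point all of whose components lie in the field generated by `√3`. -/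
def Special (z : ℂ) : Prop := ∀ k : ℕ, ∃ a b : ℚ, ht k z = a + b * √3

theorem Special.add {z w : ℂ} (hz : Special z) (hw : Special w) : Special (z + w) := by
  intro k
  obtain ⟨a, b, h⟩ := hz k
  obtain ⟨c, d, h'⟩ := hw k
  exact ⟨a + c, b + d, by rw [ht_add, h, h']; push_cast; ring⟩

theorem Special.neg {z : ℂ} (hz : Special z) : Special (-z) := by
  intro k
  obtain ⟨a, b, h⟩ := hz k
  exact ⟨-a, -b, by rw [ht_neg, h]; push_cast; ring⟩

theorem Special.surd_mul {z : ℂ} (hz : Special z) (a b : ℚ) :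
    Special (((a + b * √3 : ℝ) : ℂ) * z) := by
  intro k
  obtain ⟨c, d, h⟩ := hz k
  refine ⟨a * c + 3 * b * d, a * d + b * c, ?_⟩
  rw [ht_real_mul, h]; push_cast
  linear_combination (b * d : ℝ) * sq_sqrt_three

theorem special_of_re_im {z : ℂ} {a b c d : ℚ} (h : z.re = a + b * √3) (h' : z.im = c + d * √3) :
    Special z := by
  have h0 : ∃ a b : ℚ, ht 0 z = a + b * √3 := ⟨a, b, by rw [ht_zero, h]⟩
  have h1 : ∃ a b : ℚ, ht 1 z = a + b * √3 := by
    refine ⟨(3 * b + c) / 2, (a + d) / 2, ?_⟩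
    rw [ht_one, h, h']; push_cast; linear_combination (b / 2 : ℝ) * sq_sqrt_three
  have step : ∀ k, (∃ a b : ℚ, ht k z = a + b * √3) ∧ ∃ a b : ℚ, ht (k + 1) z = a + b * √3 := by
    intro k
    induction k with
    | zero => exact ⟨h0, h1⟩
    | succ k ih =>
      refine ⟨ih.2, ?_⟩
      obtain ⟨⟨a, b, e⟩, c, d, e'⟩ := ih
      refine ⟨3 * d - a, c - b, ?_⟩
      rw [add_assoc, ht_rec, e, e']; push_cast; linear_combination (d : ℝ) * sq_sqrt_three
  exact fun k => (step k).1

theorem Generic.add {z w : ℂ} (hz : Generic z) (hw : Special w) : Generic (z + w) := by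
  intro k a b h
  obtain ⟨c, d, h'⟩ := hw k
  apply hz k (a - c) (b - d)
  rw [ht_add, h'] at h
  push_cast; linarith

theorem Generic.neg {z : ℂ} (hz : Generic z) : Generic (-z) := by
  intro k a b h
  apply hz k (-a) (-b)
  rw [ht_neg] at h
  push_cast; linarith

theorem Generic.sub {z w : ℂ} (hz : Generic z) (hw : Special w) : Generic (z - w) := by
  rw [sub_eq_add_neg]; exact hz.add hw.neg

theorem Special.sub_generic {z w : ℂ} (hz : Special z) (hw : Generic w) : Generic (z - w) := by
  rw [sub_eq_neg_add]; exact hw.neg.add hz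

theorem Generic.rt_mul {z : ℂ} (hz : Generic z) : Generic (rt * z) := by
  intro k a b h
  apply hz (k + 11) a b
  rw [← h, ← ht_succ_rt_mul, add_assoc, ht_add_twelve]

theorem Generic.rt_pow_mul {z : ℂ} (hz : Generic z) (s : ℕ) : Generic (rt ^ s * z) := by
  induction s with
  | zero => simpa
  | succ s ih => rw [pow_succ', mul_assoc]; exact ih.rt_mul

/-- The inverse `c + d √3` of the scalar carries a relation for the product back to one for `z`. -/
theorem Generic.surd_mul {z : ℂ} (hz : Generic z) {a b : ℚ} {c d : ℚ}
    (h : (a + b * √3 : ℝ) * (c + d * √3) = 1) : Generic (((a + b * √3 : ℝ) : ℂ) * z) := by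
  intro k e f h'
  rw [ht_real_mul] at h'
  apply hz k (c * e + 3 * d * f) (c * f + d * e)
  push_cast
  linear_combination (c + d * √3) * h' - (ht k z) * h + (d * f : ℝ) * sq_sqrt_three

theorem Generic.ne_nat {z : ℂ} (hz : Generic z) (k : ℕ) (r : ℚ) : ht k z ≠ r := by
  have := hz k r 0
  simpa using this

theorem special_four : Special 4 :=
  special_of_re_im (a := 4) (b := 0) (c := 0) (d := 0) (by simp) (by simp)

/-- The rotation about the origin, followed by the half-turn about `2` where it leaves the
half-plane. -/
noncomputable def hornMap (z : ℂ) : ℂ := if ht 1 z < 1 then rt * z else 4 - rt * z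

theorem Generic.hornMap {z : ℂ} (hz : Generic z) : Generic (hornMap z) := by
  unfold OuterBilliard.hornMap
  split_ifs
  · exact hz.rt_mul
  · exact special_four.sub_generic hz.rt_mul

theorem Generic.hornMap_iterate {z : ℂ} (hz : Generic z) (n : ℕ) :
    Generic (OuterBilliard.hornMap^[n] z) := by
  induction n with
  | zero => exact hz
  | succ n ih => rw [Function.iterate_succ_apply']; exact ih.hornMap

/-! ### Soundness of the computation -/

theorem int_neg_def (x : ℤ) : Int.neg x = -x := rfl

theorem int_sub_def (x y : ℤ) : Int.sub x y = x - y := rfl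

namespace Surd

noncomputable def val (x : Surd) : ℝ := x.a + x.b * √3

theorem nonneg_sound {a b : Int} (h : nonneg a b = true) : 0 ≤ (a + b * √3 : ℝ) := by
  have h3 := sq_sqrt_three
  have hs : 0 < √3 := by positivity
  match a, b, h with
  | .ofNat m, .ofNat n, _ => simp only [Int.ofNat_eq_natCast, Int.cast_natCast]; positivity
  | .ofNat m, .negSucc n, h =>
    have h' : 3 * ((n + 1) * (n + 1)) ≤ m * m := Nat.le_of_ble_eq_true h
    have h' : (3 : ℝ) * ((n + 1) * (n + 1)) ≤ m * m := by exact_mod_cast h'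
    simp only [Int.ofNat_eq_natCast, Int.cast_natCast, Int.cast_negSucc]
    push_cast
    have : (n + 1) * √3 ≤ m := abs_le_of_sq_le_sq' (by nlinarith) (by positivity) |>.2
    linarith
  | .negSucc m, .ofNat n, h =>
    have h' : (m + 1) * (m + 1) ≤ 3 * (n * n) := Nat.le_of_ble_eq_true h
    have h' : ((m + 1) * (m + 1) : ℝ) ≤ 3 * (n * n) := by exact_mod_cast h'
    simp only [Int.ofNat_eq_natCast, Int.cast_natCast, Int.cast_negSucc]
    push_cast
    have : (m + 1 : ℝ) ≤ n * √3 := abs_le_of_sq_le_sq' (by nlinarith) (by positivity) |>.2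
    linarith
  | .negSucc m, .negSucc n, h => exact absurd h (by simp [nonneg])

theorem val_add (x y : Surd) : (x.add y).val = x.val + y.val := by
  simp only [val, add, Int.add_def, Int.cast_add]; ring

theorem val_sub (x y : Surd) : (x.sub y).val = x.val - y.val := by
  simp only [val, sub, int_sub_def, Int.cast_sub]; ring

theorem val_neg (x : Surd) : x.neg.val = -x.val := by
  simp only [val, neg, int_neg_def, Int.cast_neg]; ring

theorem val_twice (x : Surd) : x.twice.val = 2 * x.val := by
  rw [twice, val_add]; ring

theorem val_sqrtThreeMul (x : Surd) : x.sqrtThreeMul.val = √3 * x.val := by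
  simp only [val, sqrtThreeMul, Int.mul_def, Int.cast_mul]
  push_cast
  linear_combination -(x.b : ℝ) * sq_sqrt_three

theorem le_sound {x y : Surd} (h : x.le y = true) : x.val ≤ y.val := by
  have := nonneg_sound h
  have e : ((y.a.sub x.a : Int) : ℝ) + (y.b.sub x.b : Int) * √3 = (y.sub x).val := rfl
  rw [e, val_sub] at this
  linarith

end Surd

/-- The list `l` gives bounds for twice the components of `z`, starting with the `k`-th. -/
def SatFrom (z : ℂ) : ℕ → List (Option Surd) → Prop
  | _, [] => True
  | k, o :: l => (∀ c, o = some c → 2 * ht k z ≤ c.val) ∧ SatFrom z (k + 1) l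

theorem comboLe_sound {f g : Surd → Surd} {x y : Option Surd} {c : Surd}
    (h : comboLe f g x y c = true) :
    ∃ a b, x = some a ∧ y = some b ∧ (f a).val + (g b).val ≤ c.val := by
  match x, y, h with
  | some a, some b, h =>
    refine ⟨a, b, rfl, rfl, ?_⟩
    rw [← val_add]; exact le_sound h

theorem headLe_sound {z : ℂ} {k : ℕ} {l : List (Option Surd)} {c : Surd} (hl : SatFrom z k l)
    (h : headLe l c = true) : 2 * ht k z ≤ c.val := by
  unfold headLe at h
  split at h
  case h_2 => cases h
  rename_i b0 b1 b2 b3 b4 _ _ _ b8 b9 b10 b11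
  simp only [SatFrom, add_assoc, Nat.reduceAdd] at hl
  obtain ⟨g0, g1, g2, g3, g4, -, -, -, g8, g9, g10, g11, -⟩ := hl
  obtain ⟨e2, e3, e4, -, -, -, e8, e9, e10, e11⟩ := ht_all k z
  have hs : 0 < √3 := by positivity
  have h3 := sq_sqrt_three
  rw [e2] at g2; rw [e3] at g3; rw [e4] at g4; rw [e8] at g8; rw [e9] at g9
  rw [e10] at g10; rw [e11] at g11
  simp only [Bool.or_eq_true] at h
  generalize ht k z = X at *
  generalize ht (k + 1) z = Y at *
  have mono : ∀ {u v : ℝ}, u ≤ v → √3 * u ≤ √3 * v := fun h => mul_le_mul_of_nonneg_left h hs.le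
  have h3X : √3 * √3 * X = 3 * X := by rw [h3]
  have h3Y : √3 * √3 * Y = 3 * Y := by rw [h3]
  rcases h with h | h | h | h | h | h | h | h | h | h | h
  · match b0, h with
    | some a, h => exact (g0 a rfl).trans (le_sound h)
  all_goals
    obtain ⟨a, b, rfl, rfl, h'⟩ := comboLe_sound h
    simp only [id, val_twice, val_sqrtThreeMul] at h'
  · refine le_of_mul_le_mul_left ?_ hs
    linarith [g11 a rfl, g1 b rfl]
  · linarith [mono (g11 a rfl), g2 b rfl, h3X, h3Y]
  · linarith [g10 a rfl, mono (g1 b rfl), h3X, h3Y]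
  · refine le_of_mul_le_mul_left ?_ hs
    linarith [g11 a rfl, g3 b rfl]
  · refine le_of_mul_le_mul_left ?_ hs
    linarith [g9 a rfl, g1 b rfl]
  · linarith [mono (g11 a rfl), g4 b rfl, h3X, h3Y]
  · linarith [g8 a rfl, mono (g1 b rfl), h3X, h3Y]
  · linarith [g10 a rfl, g2 b rfl]
  · linarith [g10 a rfl, mono (g3 b rfl), h3X, h3Y]
  · linarith [mono (g9 a rfl), g2 b rfl, h3X, h3Y]

theorem satFrom_append {z : ℂ} {l l' : List (Option Surd)} (k : ℕ) :
    SatFrom z k (l ++ l') ↔ SatFrom z k l ∧ SatFrom z (k + l.length) l' := by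
  induction l generalizing k with
  | nil => simp [SatFrom]
  | cons o l ih =>
    rw [List.cons_append, SatFrom, SatFrom, ih, List.length_cons,
      show k + 1 + l.length = k + (l.length + 1) by ring, and_assoc]

theorem satFrom_add_twelve {z : ℂ} {l : List (Option Surd)} (k : ℕ) :
    SatFrom z (k + 12) l ↔ SatFrom z k l := by
  induction l generalizing k with
  | nil => simp [SatFrom]
  | cons o l ih => rw [SatFrom, SatFrom, ht_add_twelve, ← ih (k + 1), add_right_comm]

/-- The twelve bounds in `l` hold for the point `z`. -/
def Sat (l : List (Option Surd)) (z : ℂ) : Prop := l.length = 12 ∧ SatFrom z 0 l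

theorem implies_sound {z : ℂ} {k : ℕ} {l : List (Option Surd)} {c : Surd} (hl : Sat l z)
    (hk : k ≤ 12) (h : implies l k c = true) : 2 * ht k z ≤ c.val := by
  refine headLe_sound ?_ h
  obtain ⟨h12, hs⟩ := hl
  rw [← List.take_append_drop k l, satFrom_append, List.length_take, h12, min_eq_left hk,
    zero_add] at hs
  rw [satFrom_append, List.length_drop, h12, Nat.add_sub_cancel' hk]
  refine ⟨hs.2, ?_⟩
  rw [← zero_add 12, satFrom_add_twelve]
  exact hs.1

theorem satFrom_set {z : ℂ} {l : List (Option Surd)} {k i : ℕ} {o : Option Surd}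
    (hl : SatFrom z k l) (ho : ∀ c, o = some c → 2 * ht (k + i) z ≤ c.val) :
    SatFrom z k (l.set i o) := by
  induction l generalizing k i with
  | nil => simpa
  | cons o' l ih =>
    cases i with
    | zero => exact ⟨by simpa using ho, hl.2⟩
    | succ i => exact ⟨hl.1, ih hl.2 (by simpa [add_assoc, add_comm 1 i] using ho)⟩

theorem Sat.set {z : ℂ} {l : List (Option Surd)} {i : ℕ} {o : Option Surd}
    (hl : Sat l z) (ho : ∀ c, o = some c → 2 * ht i z ≤ c.val) : Sat (l.set i o) z :=
  ⟨by rw [List.length_set, hl.1], satFrom_set hl.2 (by simpa using ho)⟩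

theorem Sat.prune {z : ℂ} {l : List (Option Surd)} (n : ℕ) (hl : Sat l z) : Sat (prune n l) z := by
  induction n generalizing l with
  | zero => exact hl
  | succ n ih =>
    rw [OuterBilliard.prune]
    apply ih
    split
    · rename_i c _ _
      cases implies (l.set n none) n c
      · exact hl
      · exact hl.set (by simp)
    · exact hl

theorem Sat.cut {z : ℂ} {l : List (Option Surd)} {k : ℕ} {c : Surd} (hl : Sat l z)
    (h : 2 * ht k z ≤ c.val) : Sat (cut l k c) z :=
  Sat.prune 12 (hl.set (by rintro _ ⟨⟩; exact h))

namespace Cyc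

noncomputable def val (t : Cyc) : ℂ := t.a + t.b * rt + t.c * rt ^ 2 + t.d * rt ^ 3

theorem val_rot (t : Cyc) : t.rot.val = rt * t.val := by
  simp only [val, rot, Int.add_def, int_neg_def]
  push_cast
  linear_combination -(t.d : ℂ) * rt_pow_four

theorem val_flip (t : Cyc) : t.flip.val = 4 - rt * t.val := by
  simp only [val, flip, Int.add_def, int_neg_def]
  push_cast
  linear_combination (t.d : ℂ) * rt_pow_four

theorem val_re_im (t : Cyc) : t.val.re = (2 * t.a + t.c) / 2 + t.b / 2 * √3 ∧
    t.val.im = (t.b + 2 * t.d) / 2 + t.c / 2 * √3 := by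
  rw [val, rt_sq, rt_pow_three, rt]
  constructor <;> simp <;> ring

theorem two_mul_ht_zero_val (t : Cyc) : 2 * ht 0 t.val = 2 * t.a + t.c + t.b * √3 := by
  rw [ht_zero, t.val_re_im.1]; ring

theorem two_mul_ht_one_val (t : Cyc) : 2 * ht 1 t.val = 2 * t.b + t.d + (t.a + t.c) * √3 := by
  rw [ht_one, t.val_re_im.1, t.val_re_im.2]; linear_combination (t.b / 2 : ℝ) * sq_sqrt_three

end Cyc

/-- The polygons are closed and may share edges, but a generic point never has `ht 1 = 1`, so either
closed half determines the branch of `hornMap`. -/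
theorem run_sound {goal : List (Option Surd) → ℕ → Cyc → Bool} {n : ℕ} {l : List (Option Surd)}
    {s : ℕ} {t : Cyc} {y z : ℂ} (h : run goal n l s t = true) (hl : Sat l z) (hy : Generic y)
    (e : y = rt ^ s * z + t.val) :
    ∃ i ≤ n, ∃ l' s' t', goal l' s' t' = true ∧ Sat l' z ∧
      hornMap^[i] y = rt ^ s' * z + t'.val := by
  induction n generalizing l s t y with
  | zero => exact ⟨0, le_rfl, l, s, t, h, hl, e⟩
  | succ n ih =>
    rw [run, Bool.or_eq_true] at h
    rcases h with h | h
    · exact ⟨0, Nat.zero_le _, l, s, t, h, hl, e⟩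
    have e1 : ht 1 y = ht ((13 + 11 * s) % 12) z + ht 1 t.val := by
      rw [e, ht_add]
      congr 1
      apply ht_rt_pow_mul; omega
    have e2 : ht ((19 + 11 * s) % 12) z = -ht ((13 + 11 * s) % 12) z := by
      rw [← ht_add_six]; apply ht_congr; omega
    have hc : (⟨Int.sub 2 (Int.add (Int.add t.b t.b) t.d), Int.neg (Int.add t.a t.c)⟩ : Surd).val =
        2 - 2 * ht 1 t.val := by
      rw [t.two_mul_ht_one_val]
      simp only [Surd.val, Int.add_def, int_neg_def, int_sub_def]
      push_cast; ring
    have step0 : ht 1 y ≤ 1 → hornMap y = rt ^ ((s + 1) % 12) * z + t.rot.val := by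
      intro hlt
      have : ht 1 y < 1 := lt_of_le_of_ne hlt (by simpa using hy.ne_nat 1 1)
      rw [hornMap, if_pos this, e, rt_pow_mod, t.val_rot]; ring
    have step1 : 1 ≤ ht 1 y → hornMap y = rt ^ ((s + 7) % 12) * z + t.flip.val := by
      intro hlt
      rw [hornMap, if_neg (not_lt.2 hlt), e, rt_pow_mod, t.val_flip, pow_add, pow_succ rt 6,
        rt_pow_six]
      ring
    have fin : ∀ {l' s' t'}, Sat l' z → run goal n l' s' t' = true →
        hornMap y = rt ^ s' * z + Cyc.val t' → ∃ i ≤ n + 1, ∃ l' s' t', goal l' s' t' = true ∧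
          Sat l' z ∧ hornMap^[i] y = rt ^ s' * z + t'.val := by
      intro l' s' t' h1 h2 h3
      obtain ⟨i, hi, r⟩ := ih h2 h1 hy.hornMap h3
      exact ⟨i + 1, by omega, r⟩
    cases hi : implies l ((13 + 11 * s) % 12)
        ⟨Int.sub 2 (Int.add (Int.add t.b t.b) t.d), Int.neg (Int.add t.a t.c)⟩ with
    | true =>
      simp only [hi, cond_true] at h
      have := implies_sound hl (by omega) hi
      rw [hc] at this
      exact fin hl h (step0 (by linarith))
    | false =>
    cases hi' : implies l ((19 + 11 * s) % 12) (Surd.neg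
        ⟨Int.sub 2 (Int.add (Int.add t.b t.b) t.d), Int.neg (Int.add t.a t.c)⟩) with
    | true =>
      simp only [hi, hi', cond_true, cond_false] at h
      have := implies_sound hl (by omega) hi'
      rw [Surd.val_neg, hc] at this
      exact fin hl h (step1 (by linarith))
    | false =>
      simp only [hi, hi', cond_false, Bool.and_eq_true] at h
      rcases le_total (ht 1 y) 1 with hle | hle
      · exact fin (hl.cut (by rw [hc]; linarith)) h.1 (step0 hle)
      · exact fin (hl.cut (by rw [Surd.val_neg, hc]; linarith)) h.2 (step1 hle)

theorem sameInt_sound {a b : Int} (h : sameInt a b = true) : a = b := by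
  match a, b, h with
  | .ofNat m, .ofNat n, h => rw [Nat.eq_of_beq_eq_true h]
  | .negSucc m, .negSucc n, h => rw [Nat.eq_of_beq_eq_true h]

theorem goalMap_sound {s s' : ℕ} {t t' : Cyc} (h : goalMap s' t' s t = true) : s = s' ∧ t = t' := by
  cases t
  cases t'
  simp only [goalMap, Bool.and_eq_true] at h
  obtain ⟨h0, h1, h2, h3, h4⟩ := h
  exact ⟨Nat.eq_of_beq_eq_true h0, by
    rw [sameInt_sound h1, sameInt_sound h2, sameInt_sound h3, sameInt_sound h4]⟩

/-! ### Finite orbits -/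

/-- The orbit of `x` visits some point twice. -/
def FiniteOrbit {α : Type*} (f : α → α) (x : α) : Prop := ∃ m n : ℕ, m < n ∧ f^[m] x = f^[n] x

theorem FiniteOrbit.of_iterate {α : Type*} {f : α → α} {x : α} {k : ℕ}
    (h : FiniteOrbit f (f^[k] x)) : FiniteOrbit f x := by
  obtain ⟨m, n, hmn, h⟩ := h
  exact ⟨m + k, n + k, by omega, by rw [Function.iterate_add_apply, Function.iterate_add_apply, h]⟩

theorem FiniteOrbit.range_finite {α : Type*} {f : α → α} {x : α} (h : FiniteOrbit f x) :
    (Set.range fun n => f^[n] x).Finite := by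
  obtain ⟨m, n, hmn, h⟩ := h
  refine ((Set.finite_Iio n).image fun k => f^[k] x).subset ?_
  rintro _ ⟨k, rfl⟩
  induction k using Nat.strong_induction_on with
  | _ k ih =>
    rcases lt_or_ge k n with hk | hk
    · exact ⟨k, hk, rfl⟩
    · have e : f^[k] x = f^[k - n + m] x := by
        conv_lhs => rw [← Nat.sub_add_cancel hk]
        rw [Function.iterate_add_apply, Function.iterate_add_apply, h]
      simp only [e]
      exact ih _ (by omega)

/-- If the points of a finite set come back to it, then their orbits are finite. -/
theorem finiteOrbit_of_return {α : Type*} {f : α → α} {S : Set α} (hS : S.Finite)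
    (h : ∀ s ∈ S, FiniteOrbit f s ∨ ∃ n, 0 < n ∧ f^[n] s ∈ S) : ∀ s ∈ S, FiniteOrbit f s := by
  intro s hs
  by_contra hbad
  -- Without a repetition the orbit would come back to `S` at infinitely many times, and the
  -- pigeonhole principle yields one.
  have hinf : {k | f^[k] s ∈ S}.Infinite := by
    rw [Set.infinite_iff_exists_gt]
    intro a
    induction a with
    | zero =>
      rcases h s hs with h | ⟨n, hn, h⟩
      · exact absurd h hbad
      · exact ⟨n, h, hn⟩
    | succ a ih =>
      obtain ⟨k, hk, hak⟩ := ih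
      rcases h _ hk with h | ⟨n, hn, h⟩
      · exact absurd h.of_iterate hbad
      · exact ⟨n + k, by rwa [Set.mem_ofPred, Function.iterate_add_apply], by omega⟩
  obtain ⟨m, -, n, -, hne, e⟩ := hinf.exists_ne_map_eq_of_mapsTo (f := fun k => f^[k] s)
    (fun k hk => hk) hS
  rcases lt_or_gt_of_ne hne with hlt | hlt
  · exact hbad ⟨m, n, hlt, e⟩
  · exact hbad ⟨n, m, hlt, e.symm⟩

/-! ### The horn is invariant -/

/-- The points of the strip `|Im z| < 1` and of the tilted strip that crosses it which lie on the
right of the dodecagon in the middle. -/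
def Horn : Set ℂ :=
  {z | ht 9 z < 1 ∧ ht 2 z < 1 ∧ (1 < ht 10 z ∨ 1 < ht 11 z ∨ 1 < ht 0 z ∨ 1 < ht 1 z)}

theorem ht_table (z : ℂ) :
    ht 2 z = √3 * ht 1 z - ht 0 z ∧ ht 3 z = 2 * ht 1 z - √3 * ht 0 z ∧
    ht 4 z = √3 * ht 1 z - 2 * ht 0 z ∧ ht 5 z = ht 1 z - √3 * ht 0 z ∧ ht 6 z = -ht 0 z ∧
    ht 7 z = -ht 1 z ∧ ht 8 z = ht 0 z - √3 * ht 1 z ∧ ht 9 z = √3 * ht 0 z - 2 * ht 1 z ∧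
    ht 10 z = 2 * ht 0 z - √3 * ht 1 z ∧ ht 11 z = √3 * ht 0 z - ht 1 z := by
  simpa using ht_all 0 z

theorem Horn.bounds {z : ℂ} (hz : z ∈ Horn) :
    -1 < ht 2 z ∧ -1 < ht 1 z ∧ 0 < ht 0 z ∧ ht 3 z < 1 := by
  obtain ⟨h9, h2, h⟩ := hz
  obtain ⟨e2, e3, -, -, -, -, -, e9, e10, e11⟩ := ht_table z
  rw [e9] at h9
  rw [e3]
  rw [e10, e11] at h
  rw [e2] at h2 ⊢
  have h3 := sq_sqrt_three
  have hl := sqrt_three_gt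
  have hu := sqrt_three_lt
  generalize ht 0 z = X at *
  generalize ht 1 z = Y at *
  -- Multiplying the inequalities by `√3` and replacing `√3 * √3` by `3` makes the claims linear.
  have m9 : √3 * (√3 * X - 2 * Y) < √3 * 1 := by gcongr
  have m2 : √3 * (√3 * Y - X) < √3 * 1 := by gcongr
  have h3X : √3 * √3 * X = 3 * X := by rw [h3]
  have h3Y : √3 * √3 * Y = 3 * Y := by rw [h3]
  rcases h with h | h | h | h
  · have m : √3 * 1 < √3 * (2 * X - √3 * Y) := by gcongr
    refine ⟨by linarith, by linarith, by linarith, by linarith⟩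
  · have m : √3 * 1 < √3 * (√3 * X - Y) := by gcongr
    refine ⟨by linarith, by linarith, by linarith, by linarith⟩
  · have m : √3 * 1 < √3 * X := by gcongr
    refine ⟨by linarith, by linarith, by linarith, by linarith⟩
  · have m : √3 * 1 < √3 * Y := by gcongr
    refine ⟨by linarith, by linarith, by linarith, by linarith⟩

theorem ht_rt_mul (z : ℂ) : ht 0 (rt * z) = ht 11 z ∧ ht 1 (rt * z) = ht 0 z ∧
    ht 2 (rt * z) = ht 1 z ∧ ht 3 (rt * z) = ht 2 z ∧ ht 4 (rt * z) = ht 3 z ∧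
    ht 9 (rt * z) = ht 8 z ∧
    ht 10 (rt * z) = ht 9 z ∧ ht 11 (rt * z) = ht 10 z :=
  ⟨by rw [← ht_add_twelve 0, ht_succ_rt_mul], ht_succ_rt_mul _ _, ht_succ_rt_mul _ _,
    ht_succ_rt_mul _ _, ht_succ_rt_mul _ _, ht_succ_rt_mul _ _, ht_succ_rt_mul _ _,
    ht_succ_rt_mul _ _⟩

theorem ht_four : ht 0 4 = 4 ∧ ht 1 4 = 2 * √3 := by
  rw [ht_zero, ht_one]
  constructor <;> simp
  ring

/-- The rotation carries the sides `10`, `11`, `0`, `1` of the dodecagon to the next ones. A point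
beyond side `1` would cross the line `ht 2 = 1`; the half-turn about `2` brings it back, beyond side
`10`. -/
theorem hornMap_mem {z : ℂ} (hz : z ∈ Horn) (hg : Generic z) : hornMap z ∈ Horn := by
  obtain ⟨b2, b1, b0, -⟩ := Horn.bounds hz
  obtain ⟨h9, h2, h⟩ := hz
  obtain ⟨r0, r1, r2, r3, -, r9, r10, r11⟩ := ht_rt_mul z
  have r8 : ht 8 z = -ht 2 z := ht_add_six 2 z
  unfold hornMap
  split_ifs with h1
  · refine ⟨by rw [r9, r8]; linarith, by rw [r2]; exact h1, ?_⟩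
    rw [r0, r1, r11]
    rcases h with h | h | h | h
    · exact Or.inr (Or.inl h)
    · exact Or.inr (Or.inr (Or.inl h))
    · exact Or.inr (Or.inr (Or.inr h))
    · exact absurd h1 h.not_gt
  · have h1' : 1 < ht 1 z := lt_of_le_of_ne (not_lt.1 h1) (by simpa using (hg.ne_nat 1 1).symm)
    obtain ⟨e0, e1⟩ := ht_four
    obtain ⟨e2, -, -, -, -, -, -, e9, e10, -⟩ := ht_table 4
    have h3 := sq_sqrt_three
    refine ⟨?_, ?_, Or.inl ?_⟩
    · rw [ht_sub, e9, e0, e1, r9, r8]; linarith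
    · rw [ht_sub, e2, e0, e1, r2]; linarith
    · rw [ht_sub, e10, e0, e1, r10]; linarith

theorem hornMap_iterate_mem {z : ℂ} (hz : z ∈ Horn) (hg : Generic z) (n : ℕ) :
    hornMap^[n] z ∈ Horn := by
  induction n with
  | zero => exact hz
  | succ n ih => rw [Function.iterate_succ_apply']; exact hornMap_mem ih (hg.hornMap_iterate n)

/-! ### Self-similarity of the horn -/

/-- The vertex of the horn. -/
noncomputable def tip : ℂ := ⟨2 + √3, -1⟩

/-- The scaling factor of the self-similarity. -/
noncomputable def ratio : ℝ := 7 - 4 * √3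

/-- The self-similarity. -/
noncomputable def shrink (z : ℂ) : ℂ := tip + ratio * (z - tip)

theorem ratio_pos : 0 < ratio := by
  have := sqrt_three_lt
  rw [ratio]; linarith

theorem special_tip : Special tip :=
  special_of_re_im (a := 2) (b := 1) (c := -1) (d := 0) (by simp [tip]) (by simp [tip])

theorem Generic.shrink {z : ℂ} (hz : Generic z) : Generic (shrink z) := by
  rw [OuterBilliard.shrink, add_comm]
  refine Generic.add ?_ special_tip
  have h := (hz.sub special_tip).surd_mul (a := 7) (b := -4) (c := 7) (d := 4)
    (by push_cast; linear_combination -16 * sq_sqrt_three)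
  convert h using 3
  rw [ratio]; push_cast; ring

theorem Generic.of_shrink {z : ℂ} (hz : Generic (OuterBilliard.shrink z)) : Generic z := by
  have h := ((hz.sub special_tip).surd_mul (a := 7) (b := 4) (c := 7) (d := -4)
    (by push_cast; linear_combination -16 * sq_sqrt_three)).add special_tip
  convert h using 1
  have h3 : (√3 : ℂ) * √3 = 3 := by exact_mod_cast sq_sqrt_three
  rw [OuterBilliard.shrink, ratio]; push_cast
  linear_combination (16 * z - 16 * tip) * h3

theorem ht_shrink (k : ℕ) (z : ℂ) :
    ht k (shrink z) = ht k tip + ratio * (ht k z - ht k tip) := by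
  rw [shrink, ht_add, ht_real_mul, ht_sub]

theorem ht_tip : ht 0 tip = 2 + √3 ∧ ht 1 tip = 1 + √3 ∧ ht 2 tip = 1 ∧ ht 4 tip = -1 - √3 ∧
    ht 5 tip = -2 - √3 ∧ ht 6 tip = -2 - √3 ∧ ht 7 tip = -1 - √3 ∧ ht 9 tip = 1 ∧
    ht 10 tip = 1 + √3 ∧ ht 11 tip = 2 + √3 := by
  have h3 := sq_sqrt_three
  have e0 : ht 0 tip = 2 + √3 := by rw [ht_zero, tip]
  have e1 : ht 1 tip = 1 + √3 := by rw [ht_one, tip]; linear_combination h3 / 2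
  obtain ⟨e2, -, e4, e5, e6, e7, -, e9, e10, e11⟩ := ht_table tip
  rw [e0, e1] at e2 e4 e5 e9 e10 e11
  rw [e0] at e6
  rw [e1] at e7
  refine ⟨e0, e1, ?_, ?_, ?_, ?_, ?_, ?_, ?_, ?_⟩ <;> linarith

theorem two_mul_ht_shrink_le {k : ℕ} {z : ℂ} {b : ℝ} {c : Surd} (h : ht k z ≤ b)
    (e : 2 * (ht k tip + ratio * (b - ht k tip)) = c.val) : 2 * ht k (shrink z) ≤ c.val := by
  rw [← e, ht_shrink]
  have := ratio_pos
  gcongr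

/-- A point of the horn on the far side of a certain line lies in the scaled horn. -/
theorem mem_shrink_image {z : ℂ} (hz : z ∈ Horn) (h : 7 - 2 * √3 < ht 0 z) :
    z ∈ shrink '' Horn := by
  obtain ⟨e0, -, e2, -, -, -, -, e9, -, -⟩ := ht_tip
  have h3 := sq_sqrt_three
  have hl := sqrt_three_gt
  have hu := sqrt_three_lt
  -- The factor `7 + 4 √3` is the inverse of `ratio`.
  have hz' : shrink (tip + (7 + 4 * √3 : ℝ) * (z - tip)) = z := by
    have h3 : (√3 : ℂ) * √3 = 3 := by exact_mod_cast sq_sqrt_three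
    rw [shrink, ratio]; push_cast; linear_combination (16 * tip - 16 * z) * h3
  refine ⟨_, ?_, hz'⟩
  have key : ∀ k, ht k (tip + (7 + 4 * √3 : ℝ) * (z - tip)) =
      ht k tip + (7 + 4 * √3) * (ht k z - ht k tip) := fun k => by
    rw [ht_add, ht_real_mul, ht_sub]
  -- The lines `ht 9 = 1` and `ht 2 = 1` pass through the tip, so `shrink` preserves them; it
  -- carries `ht 0 = 1` to `ht 0 = 7 - 2 √3`.
  refine ⟨?_, ?_, Or.inr (Or.inr (Or.inl ?_))⟩
  · rw [key, e9]; nlinarith [hz.1]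
  · rw [key, e2]; nlinarith [hz.2.1]
  · rw [key, e0]
    have : (7 + 4 * √3) * (7 - 2 * √3) < (7 + 4 * √3) * ht 0 z := by gcongr
    linarith

theorem hornMap_of_one_lt {z : ℂ} (h : 1 < ht 1 z) :
    hornMap z = rt ^ 7 * z + (⟨4, 0, 0, 0⟩ : Cyc).val := by
  rw [hornMap, if_neg (not_lt.2 h.le), pow_succ, rt_pow_six, Cyc.val]
  push_cast; ring

theorem cyc_val_zero : (⟨0, 0, 0, 0⟩ : Cyc).val = 0 := by simp [Cyc.val]

theorem run_sound_of_one_lt {goal : List (Option Surd) → ℕ → Cyc → Bool} {n : ℕ}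
    {l : List (Option Surd)} {z : ℂ} (h : run goal n l 7 ⟨4, 0, 0, 0⟩ = true) (hl : Sat l z)
    (hz : Generic z) (h1 : 1 < ht 1 z) :
    ∃ i ≤ n, ∃ l' s t, goal l' s t = true ∧ Sat l' z ∧
      hornMap^[i + 1] z = rt ^ s * z + t.val :=
  run_sound h hl hz.hornMap (hornMap_of_one_lt h1)

theorem finiteOrbit_of_identity {z : ℂ} {i : ℕ}
    (h : hornMap^[i + 1] z = rt ^ 0 * z + (⟨0, 0, 0, 0⟩ : Cyc).val) : FiniteOrbit hornMap z :=
  ⟨0, i + 1, by omega, by rw [h, cyc_val_zero]; simp⟩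

theorem sat_mk {z : ℂ} {b0 b1 b2 b3 b4 b5 b6 b7 b8 b9 b10 b11 : Option Surd}
    (h : SatFrom z 0 [b0, b1, b2, b3, b4, b5, b6, b7, b8, b9, b10, b11]) :
    Sat [b0, b1, b2, b3, b4, b5, b6, b7, b8, b9, b10, b11] z := ⟨rfl, h⟩

theorem surd_val_int (a : Int) : (⟨a, 0⟩ : Surd).val = a := by simp [Surd.val]

theorem enter_of_one_lt {z : ℂ} (hz : z ∈ Horn) (hg : Generic z) (h1 : 1 < ht 1 z) :
    FiniteOrbit hornMap z ∨ ∃ j ≤ 85, hornMap^[j] z ∈ shrink '' Horn := by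
  have hsat : Sat [none, none, some ⟨2, 0⟩, none, none, none, none, some ⟨-2, 0⟩, none,
      some ⟨2, 0⟩, none, none] z := by
    obtain ⟨-, -, -, -, -, e7, -⟩ := ht_table z
    refine sat_mk ?_
    simp only [SatFrom, Nat.reduceAdd, reduceCtorEq, Option.some.injEq, forall_eq',
      surd_val_int, and_true, true_and, false_imp_iff, implies_true, e7]
    refine ⟨?_, ?_, ?_⟩ <;> push_cast <;> linarith [hz.1, hz.2.1]
  obtain ⟨i, hi, l, s, t, hgoal, hl, e⟩ := run_sound_of_one_lt run_deep hsat hg h1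
  rw [goalDeep, Bool.or_eq_true] at hgoal
  rcases hgoal with h | h
  · refine Or.inr ⟨i + 1, by omega, ?_⟩
    refine mem_shrink_image (hornMap_iterate_mem hz hg _) ?_
    have hb := implies_sound hl (by omega) h
    have e0 : ht 0 (hornMap^[i + 1] z) = -ht ((6 + 11 * s) % 12) z + ht 0 t.val := by
      rw [e, ht_add, ← ht_add_six]
      congr 1
      apply ht_rt_pow_mul; omega
    have h0 := t.two_mul_ht_zero_val
    simp only [Surd.val, Int.add_def, int_sub_def] at hb
    push_cast at hb
    refine lt_of_le_of_ne (by rw [e0]; linarith) ?_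
    have := (hg.hornMap_iterate (i + 1)) 0 7 (-2)
    push_cast at this
    intro h
    exact this (by linarith)
  · obtain ⟨rfl, rfl⟩ := goalMap_sound h
    exact Or.inl (finiteOrbit_of_identity e)

/-- A point of the horn is beyond side `10`, `11`, `0` or `1`, so at most three rotations bring it
to `ht 1 > 1`, where 85 further steps suffice. -/
theorem enter_shrink {z : ℂ} (hz : z ∈ Horn) (hg : Generic z) :
    FiniteOrbit hornMap z ∨ ∃ j ≤ 88, hornMap^[j] z ∈ shrink '' Horn := by
  have step : ∀ (P : ℂ → Prop) (b : ℕ), (∀ w ∈ Horn, Generic w → P w →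
      FiniteOrbit hornMap w ∨ ∃ j ≤ b, hornMap^[j] w ∈ shrink '' Horn) →
      ∀ w ∈ Horn, Generic w → (1 < ht 1 w ∨ P (rt * w)) →
      FiniteOrbit hornMap w ∨ ∃ j ≤ max 85 (b + 1), hornMap^[j] w ∈ shrink '' Horn := by
    intro P b hP w hw hgw h
    by_cases h1 : 1 < ht 1 w
    · rcases enter_of_one_lt hw hgw h1 with h | ⟨j, hj, h⟩
      · exact Or.inl h
      · exact Or.inr ⟨j, by omega, h⟩
    · have h1' : ht 1 w < 1 := lt_of_le_of_ne (not_lt.1 h1) (by simpa using hgw.ne_nat 1 1)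
      have e : hornMap w = rt * w := if_pos h1'
      have := hP (hornMap w) (hornMap_mem hw hgw) hgw.hornMap (by rw [e]; tauto)
      rcases this with h | ⟨j, hj, h⟩
      · exact Or.inl (FiniteOrbit.of_iterate (k := 1) h)
      · exact Or.inr ⟨j + 1, by omega, h⟩
  have s0 : ∀ w ∈ Horn, Generic w → 1 < ht 1 w → _ := fun w hw hgw h => enter_of_one_lt hw hgw h
  have s1 := step _ 85 s0
  have s2 := step _ 86 s1
  have s3 := step _ 87 s2
  refine s3 z hz hg ?_
  obtain ⟨r0, r1, -, -, -, -, -, r11⟩ := ht_rt_mul z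
  obtain ⟨r0', r1', -⟩ := ht_rt_mul (rt * z)
  obtain ⟨-, r1'', -⟩ := ht_rt_mul (rt * (rt * z))
  rw [r1, r1'', r1', r0', r0, r11]
  have := hz.2.2
  tauto

/-- The points whose orbit comes back, at a scaled point. -/
theorem scaled_return {z : ℂ} (hg : Generic z) (h1 : 1 < ht 1 (shrink z)) {m n s : ℕ} {t t' : Cyc}
    {l : List (Option Surd)} (hm : 0 < m) (e : hornMap^[m] z = rt ^ s * z + t.val)
    (hrun : run (goalMapOr s t') n l 7 ⟨4, 0, 0, 0⟩ = true) (hl : Sat l (shrink z))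
    (hc : shrink (rt ^ s * z + t.val) = rt ^ s * shrink z + t'.val) :
    FiniteOrbit hornMap (shrink z) ∨
      ∃ n m, 0 < n ∧ 0 < m ∧ hornMap^[n] (shrink z) = shrink (hornMap^[m] z) := by
  obtain ⟨i, -, l', s', t'', hgoal, -, e'⟩ := run_sound_of_one_lt hrun hl hg.shrink h1
  rw [goalMapOr, Bool.or_eq_true] at hgoal
  rcases hgoal with h | h
  · obtain ⟨rfl, rfl⟩ := goalMap_sound h
    exact Or.inr ⟨i + 1, m, by omega, hm, by rw [e, hc, e']⟩
  · obtain ⟨rfl, rfl⟩ := goalMap_sound h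
    exact Or.inl (finiteOrbit_of_identity e')

theorem tip_eq : tip = 2 + 2 * rt - 2 * rt ^ 3 := by
  rw [rt_pow_three, rt, tip]
  apply Complex.ext <;> simp
  · ring
  · norm_num

theorem ratio_eq : (ratio : ℂ) = 7 - 8 * rt + 4 * rt ^ 3 := by
  rw [rt_pow_three, rt, ratio]
  apply Complex.ext <;> simp
  · ring
  · norm_num

/-- Conjugation by `shrink` keeps the linear part of a motion and changes only its translation part.
The new one lies in `ℤ[ζ]` and is found by reducing modulo `ζ⁴ = ζ² - 1`. -/
theorem shrink_rotate (z : ℂ) : shrink (rt ^ 1 * z + (⟨0, 0, 0, 0⟩ : Cyc).val) =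
    rt ^ 1 * shrink z + (⟨8, 0, -16, 12⟩ : Cyc).val := by
  simp only [shrink, Cyc.val, ratio_eq, tip_eq]; push_cast
  linear_combination (-20 + 16 * rt + 8 * rt ^ 2 - 8 * rt ^ 3) * rt_pow_four

theorem shrink_flip (z : ℂ) : shrink (rt ^ 7 * z + (⟨4, 0, 0, 0⟩ : Cyc).val) =
    rt ^ 7 * shrink z + (⟨28, -24, 0, 12⟩ : Cyc).val := by
  simp only [shrink, Cyc.val, ratio_eq, tip_eq]; push_cast
  linear_combination (-12 - 4 * rt + 4 * rt ^ 2 + 4 * rt ^ 3 - 8 * rt ^ 4 + 8 * rt ^ 5 - 4 * rt ^ 6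
    + 16 * rt ^ 7 - 8 * rt ^ 9) * rt_pow_four

theorem shrink_four (z : ℂ) : shrink (rt ^ 4 * z + (⟨4, 0, 0, -4⟩ : Cyc).val) =
    rt ^ 4 * shrink z + (⟨12, -20, 20, -12⟩ : Cyc).val := by
  simp only [shrink, Cyc.val, ratio_eq, tip_eq]; push_cast
  linear_combination (4 - 8 * rt - 4 * rt ^ 3 + 16 * rt ^ 4 - 8 * rt ^ 6) * rt_pow_four

theorem shrink_five (z : ℂ) : shrink (rt ^ 5 * z + (⟨8, 0, -4, 0⟩ : Cyc).val) =
    rt ^ 5 * shrink z + (⟨64, -48, -32, 48⟩ : Cyc).val := by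
  simp only [shrink, Cyc.val, ratio_eq, tip_eq]; push_cast
  linear_combination (-20 - 12 * rt + 8 * rt ^ 3 - 4 * rt ^ 4 + 16 * rt ^ 5 - 8 * rt ^ 7) *
    rt_pow_four

/-- The scaled horn lies entirely on the side where `hornMap` makes the half-turn, so all
computations for scaled points start from the same motion. -/
theorem one_lt_ht_one_shrink {z : ℂ} (hz : z ∈ Horn) : 1 < ht 1 (shrink z) := by
  obtain ⟨-, b1, -⟩ := Horn.bounds hz
  have hl := sqrt_three_gt
  have hu := sqrt_three_lt
  obtain ⟨-, e1, -⟩ := ht_tip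
  rw [ht_shrink, e1]
  have : ratio * (-1 - (1 + √3)) < ratio * (ht 1 z - (1 + √3)) := by
    have := ratio_pos; gcongr
  rw [ratio] at *
  nlinarith [sq_sqrt_three]

section Cases

variable {z : ℂ}

/-- A step of the map, at a scaled point. -/
abbrev ScaledReturn (z : ℂ) : Prop := FiniteOrbit hornMap (shrink z) ∨
  ∃ n m, 0 < n ∧ 0 < m ∧ hornMap^[n] (shrink z) = shrink (hornMap^[m] z)

/-- The part `ht 1 < 1` of the horn, which goes around the dodecagon, is covered by three convex
pieces, beyond side `0`, `11` or `10`; each is treated by its own computation. -/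
theorem scaledReturn_of_rotate (hz : z ∈ Horn) (hg : Generic z) (h1 : ht 1 z < 1)
    {l : List (Option Surd)} (hl : Sat l (shrink z))
    (hrun : run (goalMapOr 1 ⟨8, 0, -16, 12⟩) 36 l 7 ⟨4, 0, 0, 0⟩ = true) : ScaledReturn z :=
  scaled_return hg (one_lt_ht_one_shrink hz) one_pos
    (by rw [Function.iterate_one, hornMap, if_pos h1, cyc_val_zero]; simp) hrun hl (shrink_rotate z)

theorem scaledReturn_zero (hz : z ∈ Horn) (hg : Generic z) (h1 : ht 1 z < 1) (h : 1 < ht 0 z) :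
    ScaledReturn z := by
  -- A bound `b` on a component of `z` becomes `2 * (ht k tip + ratio * (b - ht k tip))` for the
  -- scaled point: here from `ht 1 ≤ 1`, `ht 6 ≤ -1` and `ht 9 ≤ 1`. The other cases are analogous.
  refine scaledReturn_of_rotate (l := [none, some ⟨26, -12⟩, none, none, none, none, some ⟨-14, 4⟩,
    none, none, some ⟨2, 0⟩, none, none]) hz hg h1 (sat_mk ?_) (by decide +kernel)
  obtain ⟨-, -, -, -, e6, -⟩ := ht_table z
  obtain ⟨-, t1, -, -, -, t6, -, t9, -⟩ := ht_tip
  have h3 := sq_sqrt_three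
  simp only [SatFrom, Nat.reduceAdd, reduceCtorEq, Option.some.injEq, forall_eq',
    and_true, true_and, false_imp_iff, implies_true]
  refine ⟨two_mul_ht_shrink_le h1.le ?_, two_mul_ht_shrink_le (b := -1) (by linarith) ?_,
    two_mul_ht_shrink_le hz.1.le ?_⟩ <;> simp only [t1, t6, t9, ratio, Surd.val] <;> push_cast <;>
    linarith

theorem scaledReturn_eleven (hz : z ∈ Horn) (hg : Generic z) (h1 : ht 1 z < 1) (h0 : ht 0 z ≤ 1)
    (h : 1 < ht 11 z) : ScaledReturn z := by
  refine scaledReturn_of_rotate (l := [some ⟨14, -4⟩, none, none, none, none, some ⟨-14, 4⟩,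
    none, none, none, some ⟨2, 0⟩, none, none]) hz hg h1 (sat_mk ?_) (by decide +kernel)
  have e : ht 11 z = -ht 5 z := ht_add_six 5 z
  obtain ⟨t0, -, -, -, t5, -, -, t9, -⟩ := ht_tip
  have h3 := sq_sqrt_three
  simp only [SatFrom, Nat.reduceAdd, reduceCtorEq, Option.some.injEq, forall_eq',
    and_true, true_and, false_imp_iff, implies_true]
  refine ⟨two_mul_ht_shrink_le h0 ?_, two_mul_ht_shrink_le (b := -1) (by linarith) ?_,
    two_mul_ht_shrink_le hz.1.le ?_⟩ <;> simp only [t0, t5, t9, ratio, Surd.val] <;> push_cast <;>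
    linarith

theorem scaledReturn_ten (hz : z ∈ Horn) (hg : Generic z) (h1 : ht 1 z < 1) (h11 : ht 11 z ≤ 1)
    (h : 1 < ht 10 z) : ScaledReturn z := by
  refine scaledReturn_of_rotate (l := [none, none, none, none, some ⟨-26, 12⟩, none,
    none, none, none, some ⟨2, 0⟩, none, some ⟨14, -4⟩]) hz hg h1 (sat_mk ?_) (by decide +kernel)
  have e : ht 10 z = -ht 4 z := ht_add_six 4 z
  obtain ⟨-, -, -, t4, -, -, -, t9, -, t11⟩ := ht_tip
  have h3 := sq_sqrt_three
  simp only [SatFrom, Nat.reduceAdd, reduceCtorEq, Option.some.injEq, forall_eq',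
    and_true, true_and, false_imp_iff, implies_true]
  refine ⟨two_mul_ht_shrink_le (b := -1) (by linarith) ?_, two_mul_ht_shrink_le hz.1.le ?_,
    two_mul_ht_shrink_le h11 ?_⟩ <;> simp only [t4, t9, t11, ratio, Surd.val] <;> push_cast <;>
    linarith

theorem scaledReturn_flip (hz : z ∈ Horn) (hg : Generic z) (h1 : 1 < ht 1 z)
    (h11 : ht 11 z ≤ 3) : ScaledReturn z := by
  refine scaled_return (n := 83) (m := 1) (l := [none, none, some ⟨2, 0⟩, none, none, none, none,
    some ⟨-26, 12⟩, none, some ⟨2, 0⟩, none, some ⟨42, -20⟩]) hg (one_lt_ht_one_shrink hz) one_pos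
    (hornMap_of_one_lt h1) (by decide +kernel) (sat_mk ?_) (shrink_flip z)
  obtain ⟨-, -, -, -, -, e7, -⟩ := ht_table z
  obtain ⟨-, -, t2, -, -, -, t7, t9, -, t11⟩ := ht_tip
  have h3 := sq_sqrt_three
  simp only [SatFrom, Nat.reduceAdd, reduceCtorEq, Option.some.injEq, forall_eq',
    and_true, true_and, false_imp_iff, implies_true]
  refine ⟨two_mul_ht_shrink_le hz.2.1.le ?_, two_mul_ht_shrink_le (b := -1) (by linarith) ?_,
    two_mul_ht_shrink_le hz.1.le ?_, two_mul_ht_shrink_le h11 ?_⟩ <;>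
    simp only [t2, t7, t9, t11, ratio, Surd.val] <;> push_cast <;> linarith

/-- Closer to the tip, the scaled orbit is matched with several steps at once. With `y = 4 - ζ z`,
one has `ht 1 (ζ y) = 4 - ht 11 z` and `ht 1 (ζ² y) = 2 √3 - ht 10 z`, so the cuts `3` and `2 √3 -
1` decide when the next half-turn occurs. Here it is the fourth step; beyond the second cut it is
the fifth. -/
theorem scaledReturn_four (hz : z ∈ Horn) (hg : Generic z) (h1 : 1 < ht 1 z)
    (h11 : 3 ≤ ht 11 z) (h10 : ht 10 z ≤ 2 * √3 - 1) : ScaledReturn z := by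
  obtain ⟨-, -, -, -, -, e7, -⟩ := ht_table z
  obtain ⟨-, -, t2, -, t5, -, t7, t9, t10, -⟩ := ht_tip
  have e : ht 11 z = -ht 5 z := ht_add_six 5 z
  have h3 := sq_sqrt_three
  have hsat : Sat [none, none, some ⟨2, 0⟩, none, none, some ⟨-6, 0⟩, none, some ⟨-2, 0⟩, none,
      some ⟨2, 0⟩, some ⟨-2, 4⟩, none] z := by
    refine sat_mk ?_
    simp only [SatFrom, Nat.reduceAdd, reduceCtorEq, Option.some.injEq, forall_eq',
      Surd.val, and_true, true_and, false_imp_iff, implies_true, e7]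
    refine ⟨?_, ?_, ?_, ?_, ?_⟩ <;> push_cast <;> linarith [hz.1, hz.2.1]
  obtain ⟨i, -, -, s, t, hgoal, -, e'⟩ := run_sound_of_one_lt
    (goal := fun _ s t => goalMap 4 ⟨4, 0, 0, -4⟩ s t) (n := 3) (by decide +kernel) hsat hg h1
  obtain ⟨rfl, rfl⟩ := goalMap_sound hgoal
  refine scaled_return (n := 51) (l := [none, none, some ⟨2, 0⟩, none, none, some ⟨-42, 20⟩, none,
    some ⟨-26, 12⟩, none, some ⟨2, 0⟩, some ⟨-50, 32⟩, none]) hg (one_lt_ht_one_shrink hz)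
    i.succ_pos e' (by decide +kernel) (sat_mk ?_) (shrink_four z)
  simp only [SatFrom, Nat.reduceAdd, reduceCtorEq, Option.some.injEq, forall_eq',
    and_true, true_and, false_imp_iff, implies_true]
  refine ⟨two_mul_ht_shrink_le hz.2.1.le ?_, two_mul_ht_shrink_le (b := -3) (by linarith) ?_,
    two_mul_ht_shrink_le (b := -1) (by linarith) ?_, two_mul_ht_shrink_le hz.1.le ?_,
    two_mul_ht_shrink_le h10 ?_⟩ <;>
    simp only [t2, t5, t7, t9, t10, ratio, Surd.val] <;> push_cast <;> linarith

theorem scaledReturn_five (hz : z ∈ Horn) (hg : Generic z) (h1 : 1 < ht 1 z)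
    (h10 : 2 * √3 - 1 ≤ ht 10 z) : ScaledReturn z := by
  obtain ⟨-, -, t2, t4, -, -, -, t9, -, -⟩ := ht_tip
  have e : ht 10 z = -ht 4 z := ht_add_six 4 z
  have h3 := sq_sqrt_three
  have hsat : Sat [none, none, some ⟨2, 0⟩, none, some ⟨2, -4⟩, none, none, none, none,
      some ⟨2, 0⟩, none, none] z := by
    refine sat_mk ?_
    simp only [SatFrom, Nat.reduceAdd, reduceCtorEq, Option.some.injEq, forall_eq',
      Surd.val, and_true, true_and, false_imp_iff, implies_true]
    refine ⟨?_, ?_, ?_⟩ <;> push_cast <;> linarith [hz.1, hz.2.1]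
  obtain ⟨i, -, -, s, t, hgoal, -, e'⟩ := run_sound_of_one_lt
    (goal := fun _ s t => goalMap 5 ⟨8, 0, -4, 0⟩ s t) (n := 4) (by decide +kernel) hsat hg h1
  obtain ⟨rfl, rfl⟩ := goalMap_sound hgoal
  refine scaled_return (n := 76) (l := [none, none, some ⟨2, 0⟩, none, some ⟨50, -32⟩, none, none,
    none, none, some ⟨2, 0⟩, none, none]) hg (one_lt_ht_one_shrink hz)
    i.succ_pos e' (by decide +kernel) (sat_mk ?_) (shrink_five z)
  simp only [SatFrom, Nat.reduceAdd, reduceCtorEq, Option.some.injEq, forall_eq',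
    and_true, true_and, false_imp_iff, implies_true]
  refine ⟨two_mul_ht_shrink_le hz.2.1.le ?_,
    two_mul_ht_shrink_le (b := 1 - 2 * √3) (by linarith) ?_,
    two_mul_ht_shrink_le hz.1.le ?_⟩ <;>
    simp only [t2, t4, t9, ratio, Surd.val] <;> push_cast <;> linarith

theorem scaledReturn (hz : z ∈ Horn) (hg : Generic z) : ScaledReturn z := by
  rcases lt_or_ge (ht 1 z) 1 with h1 | h1
  · rcases lt_or_ge 1 (ht 0 z) with h0 | h0
    · exact scaledReturn_zero hz hg h1 h0
    rcases lt_or_ge 1 (ht 11 z) with h11 | h11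
    · exact scaledReturn_eleven hz hg h1 h0 h11
    rcases hz.2.2 with h | h | h | h
    · exact scaledReturn_ten hz hg h1 h11 h
    all_goals linarith
  · have h1 := lt_of_le_of_ne h1 (by simpa using (hg.ne_nat 1 1).symm)
    rcases le_total (ht 11 z) 3 with h11 | h11
    · exact scaledReturn_flip hz hg h1 h11
    rcases le_total (ht 10 z) (2 * √3 - 1) with h10 | h10
    · exact scaledReturn_four hz hg h1 h11 h10
    · exact scaledReturn_five hz hg h1 h10

end Cases

/-- The scaled orbit of `z` is a finite set, and by `scaledReturn` each of its points has a finite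
orbit or comes back to it. -/
theorem FiniteOrbit.shrink {z : ℂ} (hz : z ∈ Horn) (hg : Generic z) (h : FiniteOrbit hornMap z) :
    FiniteOrbit hornMap (OuterBilliard.shrink z) := by
  refine finiteOrbit_of_return (S := OuterBilliard.shrink '' Set.range fun n => hornMap^[n] z)
    (h.range_finite.image _) ?_ _ ⟨_, ⟨0, rfl⟩, rfl⟩
  rintro _ ⟨_, ⟨k, rfl⟩, rfl⟩
  rcases scaledReturn (hornMap_iterate_mem hz hg k) (hg.hornMap_iterate k) with h | ⟨n, m, hn, -, e⟩
  · exact Or.inl h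
  · refine Or.inr ⟨n, hn, _, ⟨m + k, rfl⟩, ?_⟩
    simp only [e, Function.iterate_add_apply]

end OuterBilliard

namespace OuterBilliard

/-! ### Infinite orbits in the horn have measure zero -/

open MeasureTheory

theorem norm_rt : ‖rt‖ = 1 := by
  have h : ‖rt‖ ^ 12 = 1 := by rw [← norm_pow, rt_pow_twelve, norm_one]
  exact (pow_eq_one_iff_of_nonneg (norm_nonneg _) (by norm_num)).1 h

/-- A plane motion preserves the area of every set. -/
theorem volume_preimage_motion {u : ℂ} (hu : ‖u‖ = 1) (w : ℂ) (A : Set ℂ) :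
    volume ((fun z => u * z + w) ⁻¹' A) = volume A := by
  have hu' : u ∈ Submonoid.unitSphere ℂ := by simpa [Submonoid.unitSphere] using hu
  have e : (fun z : ℂ => u * z + w) ⁻¹' A =
      (rotation ⟨u, hu'⟩).toHomeomorph.toMeasurableEquiv ⁻¹' ((fun z => z + w) ⁻¹' A) := rfl
  have hm : MeasurePreserving (rotation ⟨u, hu'⟩).toHomeomorph.toMeasurableEquiv volume volume :=
    (rotation ⟨u, hu'⟩).measurePreserving
  rw [e, hm.measure_preimage_equiv, measure_preimage_add_right]

theorem ht_continuous (k : ℕ) : Continuous (ht k) := by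
  unfold ht; fun_prop

theorem volume_ht_eq (k : ℕ) (c : ℝ) : volume {z : ℂ | ht k z = c} = 0 := by
  have h : {z : ℂ | ht k z = c} ⊆ (fun z => (starRingEnd ℂ rt) ^ k * z + 0) ⁻¹' {z | z.re = c} := by
    intro z hz
    simpa [ht] using hz
  refine measure_mono_null h ?_
  rw [volume_preimage_motion (by rw [norm_pow, RCLike.norm_conj, norm_rt, one_pow])]
  let f : ℂ →ₗ[ℝ] ℝ := Complex.reLm
  have hs : {z : ℂ | z.re = c} = AffineSubspace.mk' (c : ℂ) (LinearMap.ker f) := by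
    ext z
    simp [f, sub_eq_zero]
  rw [hs]
  refine Measure.addHaar_affineSubspace _ _ fun htop => ?_
  have : ((c + 1 : ℝ) : ℂ) ∈ AffineSubspace.mk' (c : ℂ) (LinearMap.ker f) := by
    rw [htop]; trivial
  simp [f] at this

theorem ae_generic : ∀ᵐ z : ℂ, Generic z := by
  unfold Generic
  simp only [ae_all_iff]
  intro k a b
  rw [ae_iff]
  simpa using volume_ht_eq k (a + b * √3)

/-- The points of the horn with an infinite orbit. -/
def Wandering : Set ℂ := {z | z ∈ Horn ∧ Generic z ∧ ¬FiniteOrbit hornMap z}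

/-- The images of the two branches are separated by the line `ht 4 = -1`, so the pieces of `A` on
its two sides are pulled back by one motion each. -/
theorem volume_preimage_hornMap_le (A : Set ℂ) :
    volume {z | z ∈ Horn ∧ Generic z ∧ hornMap z ∈ A} ≤ volume A := by
  have hH : MeasurableSet {w | -1 < ht 4 w} :=
    (isOpen_lt continuous_const (ht_continuous 4)).measurableSet
  have hsub : {z | z ∈ Horn ∧ Generic z ∧ hornMap z ∈ A} ⊆
      (fun z => rt * z + 0) ⁻¹' (A ∩ {w | -1 < ht 4 w}) ∪
      (fun z => -rt * z + 4) ⁻¹' (A \ {w | -1 < ht 4 w}) := by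
    rintro z ⟨hz, -, hA⟩
    obtain ⟨-, -, -, -, r4, -⟩ := ht_rt_mul z
    have e : ht 9 z = -ht 3 z := ht_add_six 3 z
    have h9 := hz.1
    unfold hornMap at hA
    split_ifs at hA with h1
    · left
      refine ⟨by simpa using hA, ?_⟩
      simp only [Set.mem_ofPred_eq, add_zero, r4]
      linarith
    · right
      rw [Set.mem_preimage, show -rt * z + 4 = 4 - rt * z by ring]
      refine ⟨hA, ?_⟩
      obtain ⟨e0, e1⟩ := ht_four
      obtain ⟨-, -, e4, -⟩ := ht_table 4
      have h3 := sq_sqrt_three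
      simp only [Set.mem_ofPred_eq, ht_sub, e4, e0, e1, r4]
      linarith
  refine (measure_mono hsub).trans ((measure_union_le _ _).trans ?_)
  rw [volume_preimage_motion norm_rt, volume_preimage_motion (by rw [norm_neg, norm_rt]),
    measure_inter_add_sdiff _ hH]

theorem volume_preimage_iterate_le (A : Set ℂ) (n : ℕ) :
    volume {z | z ∈ Horn ∧ Generic z ∧ hornMap^[n] z ∈ A} ≤ volume A := by
  induction n with
  | zero => exact measure_mono fun z hz => hz.2.2
  | succ n ih =>
    refine le_trans (measure_mono ?_) ((volume_preimage_hornMap_le _).trans ih)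
    rintro z ⟨hz, hg, hA⟩
    exact ⟨hz, hg, hornMap_mem hz hg, hg.hornMap, hA⟩

theorem volume_shrink_image (A : Set ℂ) :
    volume (shrink '' A) = ENNReal.ofReal (ratio ^ 2) * volume A := by
  have e : shrink '' A = AffineMap.homothety tip ratio '' A := by
    refine Set.image_congr fun z _ => ?_
    rw [shrink, AffineMap.homothety_apply]
    simp [add_comm]
  rw [e, Measure.addHaar_image_homothety, Complex.finrank_real_complex, abs_of_nonneg (sq_nonneg _)]

theorem volume_horn_lt_top : volume Horn < ⊤ := by
  have hb : Horn ⊆ Metric.closedBall 0 6 := by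
    intro z hz
    obtain ⟨b2, b1, b0, -⟩ := Horn.bounds hz
    obtain ⟨h9, h2, -⟩ := hz
    obtain ⟨e2, -, -, -, -, -, -, e9, -⟩ := ht_table z
    rw [e2] at h2
    rw [e9] at h9
    rw [ht_zero, ht_one] at *
    have hl := sqrt_three_gt
    have hu := sqrt_three_lt
    have h3x : √3 * √3 * z.re = 3 * z.re := by rw [sq_sqrt_three]
    have h9' : -1 < z.im := by linarith
    have hre : z.re < 4 := by nlinarith
    have him : z.im < 2 := by nlinarith
    rw [mem_closedBall_zero_iff]
    refine (Complex.norm_le_abs_re_add_abs_im z).trans ?_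
    have : |z.re| ≤ 4 := abs_le.2 ⟨by linarith, by linarith⟩
    have : |z.im| ≤ 2 := abs_le.2 ⟨by linarith, by linarith⟩
    linarith
  exact (measure_mono hb).trans_lt measure_closedBall_lt_top

theorem volume_wandering : volume Wandering = 0 := by
  have hcover : Wandering ⊆ ⋃ j ∈ Finset.range 89,
      {z | z ∈ Horn ∧ Generic z ∧ hornMap^[j] z ∈ shrink '' Wandering} := by
    rintro z ⟨hz, hg, hw⟩
    rcases enter_shrink hz hg with h | ⟨j, hj, y, hy, e⟩
    · exact absurd h hw
    -- If `y` had a finite orbit, so would `shrink y`, which is on the orbit of `z`.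
    · refine Set.mem_biUnion (x := j) (by simp; omega) ⟨hz, hg, y, ⟨hy, ?_, fun hfin => hw ?_⟩, e⟩
      · exact Generic.of_shrink (e ▸ hg.hornMap_iterate j)
      · have hgy : Generic y := Generic.of_shrink (e ▸ hg.hornMap_iterate j)
        exact FiniteOrbit.of_iterate (e ▸ hfin.shrink hy hgy)
  have hle : volume Wandering ≤ ENNReal.ofReal (89 * ratio ^ 2) * volume Wandering := by
    calc volume Wandering ≤ ∑ j ∈ Finset.range 89, volume (shrink '' Wandering) :=
          (measure_mono hcover).trans ((measure_biUnion_finset_le _ _).trans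
            (Finset.sum_le_sum fun j _ => volume_preimage_iterate_le _ j))
      _ = ENNReal.ofReal (89 * ratio ^ 2) * volume Wandering := by
          rw [Finset.sum_const, Finset.card_range, volume_shrink_image, nsmul_eq_mul, ← mul_assoc,
            ENNReal.ofReal_mul (by norm_num)]
          norm_num
  have hfin : volume Wandering ≠ ⊤ :=
    ((measure_mono fun z hz => hz.1).trans_lt volume_horn_lt_top).ne
  -- The iterates `0` to `88` give 89 terms, while `ratio ^ 2` is about `1 / 194`.
  have hlt : 89 * ratio ^ 2 < 1 := by
    have h0 := ratio_pos
    have h1 : ratio < 0.1 := by have := sqrt_three_gt; rw [ratio]; linarith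
    nlinarith
  by_contra hne
  have : ENNReal.ofReal (89 * ratio ^ 2) * volume Wandering < 1 * volume Wandering :=
    ENNReal.mul_lt_mul_left hne hfin (ENNReal.ofReal_lt_one.2 hlt)
  rw [one_mul] at this
  exact absurd hle this.not_ge

/-! ### The normalised table -/

/-- The regular dodecagon with center `0` and apothem `1`. -/
def table : Set ℂ := {z | ∀ k, ht k z ≤ 1}

/-- A vertex of the table. -/
noncomputable def vert : ℂ := ⟨2 - √3, 1⟩

theorem special_vert : Special vert :=
  special_of_re_im (a := 2) (b := -1) (c := 1) (d := 0) (by simp [vert]; ring) (by simp [vert])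

theorem ht_vert : ht 0 vert = 2 - √3 ∧ ht 1 vert = √3 - 1 ∧ ht 2 vert = 1 ∧ ht 3 vert = 1 := by
  have h3 := sq_sqrt_three
  have e0 : ht 0 vert = 2 - √3 := by rw [ht_zero, vert]
  have e1 : ht 1 vert = √3 - 1 := by rw [ht_one, vert]; linear_combination -h3 / 2
  obtain ⟨e2, e3, -⟩ := ht_table vert
  rw [e0, e1] at e2 e3
  refine ⟨e0, e1, ?_, ?_⟩ <;> linarith

theorem vert_mem_table : vert ∈ table := by
  intro k
  rw [← ht_mod]
  have hk : k % 12 < 12 := Nat.mod_lt _ (by norm_num)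
  obtain ⟨e0, e1, -, -⟩ := ht_vert
  obtain ⟨e2, e3, e4, e5, e6, e7, e8, e9, e10, e11⟩ := ht_table vert
  have h3 := sq_sqrt_three
  have hl := sqrt_three_gt
  have hu := sqrt_three_lt
  rw [e0, e1] at e2 e3 e4 e5 e8 e9 e10 e11
  rw [e0] at e6
  rw [e1] at e7
  interval_cases k % 12 <;> linarith

theorem rt_pow_mul_mem_table {z : ℂ} (hz : z ∈ table) (s : ℕ) : rt ^ s * z ∈ table := by
  intro k
  rw [ht_rt_pow_mul (l := k + 11 * s) (by omega)]
  exact hz _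

theorem rt_pow_cancel (s : ℕ) (z : ℂ) : rt ^ (11 * s) * (rt ^ s * z) = z := by
  rw [← mul_assoc, ← pow_add, show 11 * s + s = 12 * s by ring, pow_mul, rt_pow_twelve, one_pow,
    one_mul]

theorem rt_pow_cancel' (s : ℕ) (z : ℂ) : rt ^ s * (rt ^ (11 * s) * z) = z := by
  rw [← mul_assoc, ← pow_add, add_comm, pow_add, mul_assoc, rt_pow_cancel]

theorem rt_pow_mul_mem_table_iff {z : ℂ} {s : ℕ} : rt ^ s * z ∈ table ↔ z ∈ table := by
  refine ⟨fun h => ?_, fun h => rt_pow_mul_mem_table h s⟩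
  rw [← rt_pow_cancel s z]
  exact rt_pow_mul_mem_table h _

theorem convex_table : Convex ℝ table := by
  intro z hz w hw a b ha hb hab k
  rw [Complex.real_smul, Complex.real_smul, ht_add, ht_real_mul, ht_real_mul]
  have := mul_le_mul_of_nonneg_left (hz k) ha
  have := mul_le_mul_of_nonneg_left (hw k) hb
  linarith

theorem eq_rt_pow_mul (k : ℕ) (z : ℂ) :
    z = rt ^ k * (ht k z + ht (k + 3) z * Complex.I) := by
  have h : (ht k z + ht (k + 3) z * Complex.I : ℂ) = starRingEnd ℂ rt ^ k * z := by
    have e : starRingEnd ℂ rt ^ 3 = -Complex.I := by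
      rw [← map_pow, rt_pow_three, Complex.conj_I]
    apply Complex.ext
    · simp [ht]
    · simp only [ht, pow_add, e]
      simp
  rw [h, ← mul_assoc, ← mul_pow, mul_comm rt, conj_rt_mul_rt, one_pow, one_mul]

theorem table_eq_convexHull :
    table = convexHull ℝ (Set.range fun k : Fin 12 => rt ^ (k : ℕ) * vert) := by
  have hrange : ∀ m : ℕ, rt ^ m * vert ∈ convexHull ℝ (Set.range fun k : Fin 12 =>
      rt ^ (k : ℕ) * vert) := fun m => subset_convexHull _ _
    ⟨⟨m % 12, Nat.mod_lt _ (by norm_num)⟩, by simp only [rt_pow_mod]⟩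
  refine Set.Subset.antisymm (fun z hz => ?_) (convexHull_min ?_ convex_table)
  -- For the direction `k` of the largest component, `z` lies in the triangle spanned by `0` and the
  -- side `k`. The ends of that side are `rt ^ k * (1 ± (2 - √3) * I)`, whence the barycentric
  -- weights with `2 + √3 = 1 / (2 - √3)`.
  · obtain ⟨k, -, hk⟩ := Finset.exists_max_image (Finset.range 12) (fun k => ht k z) ⟨0, by simp⟩
    have hmax : ∀ j, ht j z ≤ ht k z := fun j => by
      rw [← ht_mod j]; exact hk _ (by simpa using Nat.mod_lt _ (by norm_num))
    have h1 := hmax (k + 1)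
    have h11 := hmax (k + 11)
    obtain ⟨-, e3, -, -, -, -, -, -, -, e11⟩ := ht_all k z
    have h3 := sq_sqrt_three
    have hl := sqrt_three_gt
    have hu := sqrt_three_lt
    have hz1 := hz k
    have hrep := eq_rt_pow_mul k z
    have hinv : (2 - √3) * (2 + √3) = 1 := by linear_combination -h3
    rw [e3] at hrep
    rw [e11] at h11
    generalize ht k z = M at *
    generalize ht (k + 1) z = Y at *
    have hM : 0 ≤ M := by nlinarith
    have hα : 0 ≤ (M + (2 + √3) * (2 * Y - √3 * M)) / 2 := by
      have : 0 ≤ (2 + √3) * (M - (√3 * M - Y)) := by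
        refine mul_nonneg (by linarith) (by linarith)
      linarith [show (√3 * √3 * M = 3 * M) by rw [h3]]
    have hβ : 0 ≤ (M - (2 + √3) * (2 * Y - √3 * M)) / 2 := by
      have : 0 ≤ (2 + √3) * (M - Y) := mul_nonneg (by linarith) (by linarith)
      linarith [show (√3 * √3 * M = 3 * M) by rw [h3]]
    have h0 : (0 : ℂ) ∈ convexHull ℝ (Set.range fun k : Fin 12 => rt ^ (k : ℕ) * vert) := by
      have := (convex_convexHull ℝ _) (hrange 0) (hrange 6) (a := 1 / 2) (b := 1 / 2)
        (by norm_num) (by norm_num) (by norm_num)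
      rwa [rt_pow_six, pow_zero, neg_one_mul, smul_neg, one_mul, add_neg_cancel] at this
    have key := (convex_convexHull ℝ (Set.range fun k : Fin 12 => rt ^ (k : ℕ) * vert)).sum_mem
      (t := Finset.univ) (w := ![(M + (2 + √3) * (2 * Y - √3 * M)) / 2,
        (M - (2 + √3) * (2 * Y - √3 * M)) / 2, 1 - M])
      (z := ![rt ^ (k + 10) * vert, rt ^ (k + 9) * vert, 0])
      (by intro i _; fin_cases i <;> simp <;> linarith)
      (by rw [Fin.sum_univ_three]; simp; ring)
      (by intro i _; fin_cases i
          · exact hrange _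
          · exact hrange _
          · exact h0)
    convert key using 1
    have hA : rt ^ 10 * vert = 1 + (2 - √3) * Complex.I := by
      rw [show rt ^ 10 = rt ^ 6 * rt ^ 3 * rt by ring, rt_pow_six, rt_pow_three, rt, vert]
      apply Complex.ext <;> simp <;> linarith
    have hB : rt ^ 9 * vert = 1 - (2 - √3) * Complex.I := by
      rw [show rt ^ 9 = rt ^ 6 * rt ^ 3 by ring, rt_pow_six, rt_pow_three, vert]
      apply Complex.ext <;> simp
    rw [Fin.sum_univ_three]
    simp only [Matrix.cons_val, smul_zero, add_zero, Complex.real_smul, pow_add, mul_assoc, hA, hB]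
    have hinv' : (2 - (√3 : ℂ)) * (2 + √3) = 1 := by exact_mod_cast hinv
    rw [hrep]; push_cast
    linear_combination -(rt ^ k * Complex.I * (2 * Y - √3 * M)) * hinv'
  · rintro _ ⟨k, rfl⟩
    exact rt_pow_mul_mem_table vert_mem_table _

/-- Directions `2` and `3` enclose the angle π/6, whose sine is `1 / 2`. -/
theorem cross_eq (e d : ℂ) : cross e d = 2 * (ht 2 e * ht 3 d - ht 3 e * ht 2 d) := by
  have h3 := sq_sqrt_three
  have key : ∀ z, ht 2 z = (z.re + √3 * z.im) / 2 ∧ ht 3 z = z.im := by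
    intro z
    obtain ⟨e2, e3, -⟩ := ht_table z
    rw [ht_zero, ht_one] at e2 e3
    constructor
    · rw [e2]; linear_combination z.re / 2 * h3
    · rw [e3]; ring
  rw [(key e).1, (key e).2, (key d).1, (key d).2, cross]
  ring

/-! ### The outer billiard map about the table -/

/-- The points that are mapped through the vertex `vert`. -/
def Wedge : Set ℂ := {p | ht 3 p < 1 ∧ 1 < ht 2 p}

theorem Wedge.not_mem_table {p : ℂ} (hp : p ∈ Wedge) : p ∉ table := fun h => (h 2).not_gt hp.2

theorem Wedge.isRightTangencyPoint {p : ℂ} (hp : p ∈ Wedge) :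
    IsRightTangencyPoint table p vert := by
  refine ⟨vert_mem_table, fun w hw hne => ?_⟩
  obtain ⟨e0, e1, e2, e3⟩ := ht_vert
  have hc : cross (vert - p) (w - p) = cross (w - vert) (p - vert) := by
    simp only [cross, Complex.sub_re, Complex.sub_im]; ring
  rw [hc, cross_eq]
  have a2 : ht 2 (w - vert) ≤ 0 := by rw [ht_sub, e2]; linarith [hw 2]
  have a3 : ht 3 (w - vert) ≤ 0 := by rw [ht_sub, e3]; linarith [hw 3]
  have b2 : 0 < ht 2 (p - vert) := by rw [ht_sub, e2]; linarith [hp.2]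
  have b3 : ht 3 (p - vert) < 0 := by rw [ht_sub, e3]; linarith [hp.1]
  rcases a2.lt_or_eq with h | h
  · nlinarith [mul_pos_of_neg_of_neg h b3]
  rcases a3.lt_or_eq with h' | h'
  · nlinarith [mul_pos_of_neg_of_neg h' (neg_lt_zero.2 b2)]
  exfalso
  apply hne
  obtain ⟨-, e3', -⟩ := ht_all 2 (w - vert)
  obtain ⟨f0, -⟩ := ht_table (w - vert)
  have hz := eq_rt_pow_mul 2 (w - vert)
  have h5 := ht_all 2 (w - vert)
  simp only [Nat.reduceAdd] at h5
  rw [show 2 + 3 = 5 from rfl, h5.2.1, h, h'] at hz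
  simpa [sub_eq_zero] using hz

theorem isRightTangencyPoint_rt_pow_mul {p v : ℂ} (s : ℕ) (h : IsRightTangencyPoint table p v) :
    IsRightTangencyPoint table (rt ^ s * p) (rt ^ s * v) := by
  refine ⟨rt_pow_mul_mem_table h.1 s, fun w hw hne => ?_⟩
  have hw' : rt ^ (11 * s) * w ∈ table := rt_pow_mul_mem_table hw _
  have key := h.2 _ hw' (fun e => hne (by rw [← e, rt_pow_cancel']))
  have hrot : ∀ (u a b : ℂ), cross (u * a) (u * b) = Complex.normSq u * cross a b := by
    intro u a b
    simp only [cross, Complex.mul_re, Complex.mul_im, Complex.normSq_apply]; ring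
  have hn : Complex.normSq (rt ^ s) = 1 := by
    rw [Complex.normSq_eq_norm_sq, norm_pow, norm_rt, one_pow, one_pow]
  rw [show w = rt ^ s * (rt ^ (11 * s) * w) from (rt_pow_cancel' s w).symm, ← mul_sub, ← mul_sub,
    hrot, hn, one_mul]
  exact key

/-- The generic points outside the table. -/
def Outside : Set ℂ := {p | Generic p ∧ p ∉ table}

theorem Outside.rt_pow_mul {p : ℂ} (hp : p ∈ Outside) (s : ℕ) : rt ^ s * p ∈ Outside :=
  ⟨hp.1.rt_pow_mul s, fun h => hp.2 (rt_pow_mul_mem_table_iff.1 h)⟩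

theorem exists_wedge {p : ℂ} (hp : p ∈ Outside) :
    ∃ s : ℕ, ∃ q ∈ Wedge, Generic q ∧ p = rt ^ s * q := by
  obtain ⟨hg, hp⟩ := hp
  obtain ⟨k₀, hk₀⟩ : ∃ k, 1 < ht k p := by
    by_contra h
    exact hp fun k => not_lt.1 fun hk => h ⟨k, hk⟩
  obtain ⟨k, hk, hk'⟩ : ∃ k, 1 < ht k p ∧ ¬1 < ht (k + 1) p := by
    by_contra h
    have all : ∀ i, 1 < ht (k₀ + i) p := by
      intro i
      induction i with
      | zero => exact hk₀
      | succ i ih => by_contra h'; exact h ⟨_, ih, h'⟩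
    have := all 6
    rw [ht_add_six] at this
    linarith
  refine ⟨k + 10, rt ^ (11 * (k + 10)) * p, ⟨?_, ?_⟩, hg.rt_pow_mul _, (rt_pow_cancel' _ _).symm⟩
  · rw [ht_rt_pow_mul (l := k + 1) (by omega)]
    exact lt_of_le_of_ne (not_lt.1 hk') (by simpa using hg.ne_nat (k + 1) 1)
  · rwa [ht_rt_pow_mul (l := k) (by omega)]

open Classical in
/-- The outer billiard map about the table, as a total map. -/
noncomputable def step (p : ℂ) : ℂ :=
  if h : ∃ v, IsRightTangencyPoint table p v then 2 * h.choose - p else p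

theorem step_eq {p v : ℂ} (h : IsRightTangencyPoint table p v) : step p = 2 * v - p := by
  have hex : ∃ v, IsRightTangencyPoint table p v := ⟨v, h⟩
  rw [step, dif_pos hex, hex.choose_spec.unique h]

theorem step_wedge {p : ℂ} (hp : p ∈ Wedge) : step p = 2 * vert - p :=
  step_eq (Wedge.isRightTangencyPoint hp)

theorem exists_tangency {p : ℂ} (hp : p ∈ Outside) :
    ∃ v, IsRightTangencyPoint table p v ∧ Special v := by
  obtain ⟨s, q, hq, -, rfl⟩ := exists_wedge hp
  refine ⟨_, isRightTangencyPoint_rt_pow_mul s (Wedge.isRightTangencyPoint hq), fun k => ?_⟩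
  obtain ⟨a, b, h⟩ := special_vert (k + 11 * s)
  exact ⟨a, b, by rw [ht_rt_pow_mul (l := k + 11 * s) (by omega), h]⟩

theorem step_rt_pow_mul {p : ℂ} (hp : p ∈ Outside) (s : ℕ) :
    step (rt ^ s * p) = rt ^ s * step p := by
  obtain ⟨v, hv, -⟩ := exists_tangency hp
  rw [step_eq hv, step_eq (isRightTangencyPoint_rt_pow_mul s hv)]; ring

theorem step_mem {p : ℂ} (hp : p ∈ Outside) : step p ∈ Outside := by
  obtain ⟨v, hv, hs⟩ := exists_tangency hp
  rw [step_eq hv]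
  refine ⟨?_, fun h => ?_⟩
  · rw [two_mul]; exact (hs.add hs).sub_generic hp.1
  · have hne : 2 * v - p ≠ v := fun e => hp.2 (by
      rw [show p = v by linear_combination -e]; exact hv.1)
    have := hv.2 _ h hne
    simp [cross] at this
    linarith

theorem step_iterate_mem {p : ℂ} (hp : p ∈ Outside) (n : ℕ) : step^[n] p ∈ Outside := by
  induction n with
  | zero => exact hp
  | succ n ih => rw [Function.iterate_succ_apply']; exact step_mem ih

theorem step_iterate_rt_pow_mul {p : ℂ} (hp : p ∈ Outside) (s n : ℕ) :
    step^[n] (rt ^ s * p) = rt ^ s * step^[n] p := by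
  induction n with
  | zero => rfl
  | succ n ih =>
    rw [Function.iterate_succ_apply', Function.iterate_succ_apply', ih,
      step_rt_pow_mul (step_iterate_mem hp n)]

/-- With a common image, two different tangency points would each have to lie strictly on the same
side of the other's tangent, giving opposite signs to one determinant. -/
theorem step_injOn : Set.InjOn step Outside := by
  intro p hp p' hp' e
  obtain ⟨v, hv, -⟩ := exists_tangency hp
  obtain ⟨v', hv', -⟩ := exists_tangency hp'
  rw [step_eq hv, step_eq hv'] at e
  by_cases hvv : v = v'
  · subst hvv
    linear_combination -e
  have h1 := hv.2 v' hv'.1 (Ne.symm hvv)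
  have h2 := hv'.2 v hv.1 hvv
  have hp'' : p' = 2 * v' - 2 * v + p := by linear_combination e
  subst hp''
  simp [cross] at h1 h2
  linarith

theorem step_iterate_mem_iter {p : ℂ} (hp : p ∈ Outside) (n : ℕ) :
    step^[n] p ∈ iter (outerBilliard table) n p := by
  induction n with
  | zero => exact Part.mem_some p
  | succ n ih =>
    refine Part.mem_bind ih ?_
    have hm := step_iterate_mem hp n
    obtain ⟨v, hv, -⟩ := exists_tangency hm
    rw [Function.iterate_succ_apply', mem_outerBilliard]
    exact ⟨hm.2, v, hv, step_eq hv⟩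

theorem isPeriodic_of_finiteOrbit {p : ℂ} (hp : p ∈ Outside) (h : FiniteOrbit step p) :
    IsPeriodic table p := by
  obtain ⟨m, n, hmn, h⟩ := h
  refine ⟨n - m, by omega, ?_⟩
  have e : step^[n - m] p = p := by
    have hinj := step_injOn.iterate (fun p hp => step_mem hp) m
    apply hinj (step_iterate_mem hp _) hp
    rw [← Function.iterate_add_apply, h]
    congr 2
    omega
  have := step_iterate_mem_iter hp (n - m)
  rwa [e] at this

theorem finiteOrbit_rt_pow_mul {p : ℂ} (hp : p ∈ Outside) {s : ℕ} (h : FiniteOrbit step p) :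
    FiniteOrbit step (rt ^ s * p) := by
  obtain ⟨m, n, hmn, h⟩ := h
  exact ⟨m, n, hmn, by rw [step_iterate_rt_pow_mul hp, step_iterate_rt_pow_mul hp, h]⟩

/-- If the points of a finite set come back to it up to rotations, then their orbits are finite. -/
theorem finiteOrbit_of_return_mod {S : Set ℂ} (hS : S.Finite) (hO : S ⊆ Outside)
    (h : ∀ p ∈ S, ∃ n, 0 < n ∧ ∃ s : ℕ, ∃ q ∈ S, step^[n] p = rt ^ s * q) :
    ∀ p ∈ S, FiniteOrbit step p := by
  intro p hp
  refine finiteOrbit_of_return (S := ⋃ s ∈ Finset.range 12, (fun q => rt ^ s * q) '' S)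
    (Set.Finite.biUnion (Finset.finite_toSet _) fun s _ => hS.image _) ?_ p
    (Set.mem_biUnion (x := 0) (by simp) ⟨p, hp, by simp⟩)
  intro q hq
  simp only [Set.mem_iUnion] at hq
  obtain ⟨s, hs, q, hq, rfl⟩ := hq
  obtain ⟨n, hn, s', q', hq', e⟩ := h q hq
  refine Or.inr ⟨n, hn, Set.mem_biUnion (x := (s + s') % 12)
    (by simpa using Nat.mod_lt _ (by norm_num)) ⟨q', hq', ?_⟩⟩
  simp only [rt_pow_mod]
  rw [step_iterate_rt_pow_mul (hO hq), e, pow_add, mul_assoc]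

theorem Wedge.mem_outside {p : ℂ} (hp : p ∈ Wedge) (hg : Generic p) : p ∈ Outside :=
  ⟨hg, Wedge.not_mem_table hp⟩

/-! ### Reduction to the strip and to the horn map -/

/-- Up to half-turns, the map acts on a wedge by translations. -/
theorem step_iterate_translate {p : ℂ} {m : ℕ} (hg : Generic p) (h3 : ht 3 p < 1)
    (h2 : 2 * m - 1 < ht 2 p) :
    ∀ i ≤ m, step^[i] p = rt ^ (6 * i) * (p - 2 * i * vert) := by
  intro i hi
  induction i with
  | zero => simp
  | succ i ih =>
    have hi' : (i : ℝ) + 1 ≤ m := by exact_mod_cast hi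
    obtain ⟨-, -, e2, e3⟩ := ht_vert
    have hv : ∀ k, ht k (p - 2 * i * vert) = ht k p - 2 * i * ht k vert := fun k => by
      rw [ht_sub, show (2 * i * vert : ℂ) = ((2 * i : ℝ) : ℂ) * vert by push_cast; rfl, ht_real_mul]
    have hw : p - 2 * i * vert ∈ Wedge := by
      refine ⟨?_, ?_⟩
      · rw [hv, e3]
        have : (0 : ℝ) ≤ i := i.cast_nonneg
        linarith
      · rw [hv, e2]; linarith
    have hg' : Generic (p - 2 * i * vert) := by
      have := special_vert.surd_mul (2 * i) 0
      push_cast at this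
      rw [zero_mul, add_zero] at this
      exact hg.sub this
    rw [Function.iterate_succ_apply', ih (by omega), step_rt_pow_mul (Wedge.mem_outside hw hg'),
      step_wedge hw, show 6 * (i + 1) = 6 * i + 6 by ring, pow_add, rt_pow_six]
    push_cast; ring

theorem generic_add_four_mul {z : ℂ} (hg : Generic z) (n : ℕ) : Generic (4 * n + z) := by
  have h := special_four.surd_mul n 0
  push_cast at h
  rw [zero_mul, add_zero] at h
  rw [show (4 * n + z : ℂ) = z + n * 4 by ring]
  exact hg.add h

theorem ht_two_add_four_mul (z : ℂ) (n : ℕ) : ht 2 (4 * n + z) = 2 * n + ht 2 z := by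
  obtain ⟨e0, e1⟩ := ht_four
  obtain ⟨e2, -⟩ := ht_table 4
  rw [ht_add, show (4 * n : ℂ) = ((n : ℝ) : ℂ) * 4 by push_cast; ring, ht_real_mul, e2, e0, e1]
  linear_combination 2 * n * sq_sqrt_three

theorem ht_three_add_four_mul (z : ℂ) (n : ℕ) : ht 3 (4 * n + z) = ht 3 z := by
  obtain ⟨e0, e1⟩ := ht_four
  obtain ⟨-, e3, -⟩ := ht_table 4
  rw [ht_add, show (4 * n : ℂ) = ((n : ℝ) : ℂ) * 4 by push_cast; ring, ht_real_mul, e3, e0, e1]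
  ring

/-- Equivalently `2 * vert = 4 - 4 ζ⁻¹`: translating by `-2 n * vert` carries the centre `4 n` of a
cell to `ζ⁻¹ * (4 n)`, so undoing that rotation turns the cell about its centre. -/
theorem two_sub_vert : rt * (2 - vert) = 2 := by
  have h3 := sq_sqrt_three
  rw [rt, vert]
  apply Complex.ext <;> simp
  · linarith
  · ring

/-- The cells of the strip: up to rotations, an iterate of the map rotates the `n`-th cell about
its center. -/
theorem step_iterate_cell {x : ℂ} (n : ℕ) (hg : Generic x) (h2 : -1 < ht 2 x) (h3 : ht 3 x < 1) :
    step^[n] (4 * n + x) = rt ^ (6 * n + 11) * (4 * n + rt * x) := by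
  rw [step_iterate_translate (m := n) (generic_add_four_mul hg n)
    (by rwa [ht_three_add_four_mul]) (by rw [ht_two_add_four_mul]; linarith) n le_rfl, pow_add]
  have e : rt ^ 11 * rt = 1 := by rw [← pow_succ, rt_pow_twelve]
  linear_combination -(rt ^ (6 * n) * (4 * n - 2 * n * vert + x)) * e +
    2 * n * rt ^ 11 * rt ^ (6 * n) * two_sub_vert

/-- The point of the strip that is represented by the point `x` of the horn. -/
noncomputable def strip (σ : Bool) (n : ℕ) (x : ℂ) : ℂ :=
  cond σ (4 * (n + 1 : ℕ) + -x) (4 * n + x)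

theorem strip_mem_outside (σ : Bool) (n : ℕ) {x : ℂ} (hx : x ∈ Horn) (hg : Generic x) :
    strip σ n x ∈ Outside := by
  obtain ⟨b2, -⟩ := Horn.bounds hx
  have hx2 := hx.2.1
  cases σ
  · refine ⟨generic_add_four_mul hg n, fun h => ?_⟩
    rcases n.eq_zero_or_pos with rfl | hn
    · have : x ∈ table := by simpa [strip] using h
      rcases hx.2.2 with h | h | h | h <;> exact absurd h (this _).not_gt
    · have := h 2
      rw [strip, cond_false, ht_two_add_four_mul] at this
      have : (1 : ℝ) ≤ n := by exact_mod_cast hn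
      linarith
  · refine ⟨generic_add_four_mul hg.neg _, fun h => ?_⟩
    have := h 2
    rw [strip, cond_true, ht_two_add_four_mul, ht_neg] at this
    push_cast at this
    have : (0 : ℝ) ≤ n := n.cast_nonneg
    linarith

/-- A corner point that leaves its cell enters the neighbouring one: `4 n + ζ x = 4 (n + 1) - (4 - ζ
x)`. The flag `σ` tells which of the two facing corners is meant. -/
theorem rotate_strip (σ : Bool) (n : ℕ) (x : ℂ) :
    ∃ σ', cond σ (4 * (n + 1 : ℕ) + rt * -x) (4 * n + rt * x) = strip σ' n (hornMap x) := by
  unfold hornMap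
  split_ifs
  · refine ⟨σ, ?_⟩
    cases σ <;> simp [strip]
  · refine ⟨!σ, ?_⟩
    cases σ <;> simp [strip] <;> ring

theorem step_iterate_strip (σ : Bool) (n : ℕ) {x : ℂ} (hx : x ∈ Horn) (hg : Generic x) :
    ∃ (s : ℕ) (σ' : Bool),
      step^[cond σ (n + 1) n] (strip σ n x) = rt ^ s * strip σ' n (hornMap x) := by
  obtain ⟨b2, -, -, b3⟩ := Horn.bounds hx
  obtain ⟨σ', e⟩ := rotate_strip σ n x
  have h9 : ht 9 x = -ht 3 x := ht_add_six 3 x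
  have hx9 := hx.1
  have hx2 := hx.2.1
  cases σ
  · exact ⟨_, σ', by rw [← e]; exact step_iterate_cell n hg b2 b3⟩
  · exact ⟨_, σ', by
      rw [← e]
      exact step_iterate_cell (n + 1) hg.neg (by rw [ht_neg]; linarith)
        (by rw [ht_neg]; linarith)⟩

/-- Near the table the horn is rotated until it is left. -/
theorem exists_half_turn {x : ℂ} (hx : x ∈ Horn) (hg : Generic x) :
    ∃ s i : ℕ, x = rt ^ s * strip true 0 (hornMap^[i] x) := by
  have cascade : ∀ P : ℂ → Prop, (∀ w ∈ Horn, Generic w → P w →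
      ∃ s i : ℕ, w = rt ^ s * strip true 0 (hornMap^[i] w)) →
      ∀ w ∈ Horn, Generic w → (1 < ht 1 w ∨ P (rt * w)) →
      ∃ s i : ℕ, w = rt ^ s * strip true 0 (hornMap^[i] w) := by
    intro P hP w hw hgw h
    have e11 : rt ^ 11 * rt = 1 := by rw [← pow_succ, rt_pow_twelve]
    by_cases h1 : 1 < ht 1 w
    · refine ⟨11, 1, ?_⟩
      rw [Function.iterate_one, hornMap, if_neg h1.not_gt, strip, cond_true]
      push_cast
      linear_combination -w * e11
    · have h1' : ht 1 w < 1 := lt_of_le_of_ne (not_lt.1 h1) (by simpa using hgw.ne_nat 1 1)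
      have e : hornMap w = rt * w := if_pos h1'
      obtain ⟨s, i, h⟩ := hP (hornMap w) (hornMap_mem hw hgw) hgw.hornMap (by rw [e]; tauto)
      refine ⟨11 + s, i + 1, ?_⟩
      rw [Function.iterate_succ_apply, pow_add, mul_assoc, ← h, e]
      linear_combination -w * e11
  have s0 := cascade (fun _ => False) (fun w _ _ h => h.elim)
  have s1 := cascade _ (fun w hw hgw (h : 1 < ht 1 w) => s0 w hw hgw (Or.inl h))
  have s2 := cascade _ s1
  have s3 := cascade _ s2
  refine s3 x hx hg ?_
  obtain ⟨r0, r1, -, -, -, -, -, r11⟩ := ht_rt_mul x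
  obtain ⟨r0', r1', -⟩ := ht_rt_mul (rt * x)
  obtain ⟨-, r1'', -⟩ := ht_rt_mul (rt * (rt * x))
  rw [r1, r1'', r1', r0', r0, r11]
  have := hx.2.2
  tauto

theorem finiteOrbit_strip (σ : Bool) (n : ℕ) {x : ℂ} (hx : x ∈ Horn) (hg : Generic x)
    (h : FiniteOrbit hornMap x) : FiniteOrbit step (strip σ n x) := by
  have hmem : ∀ i, hornMap^[i] x ∈ Horn := hornMap_iterate_mem hx hg
  have hgen : ∀ i, Generic (hornMap^[i] x) := hg.hornMap_iterate
  refine finiteOrbit_of_return_mod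
    (S := ⋃ σ : Bool, strip σ n '' Set.range fun i => hornMap^[i] x)
    (Set.finite_iUnion fun σ => h.range_finite.image _) ?_ ?_ _
    (Set.mem_iUnion.2 ⟨σ, x, ⟨0, rfl⟩, rfl⟩)
  · refine Set.iUnion_subset fun σ => ?_
    rintro _ ⟨_, ⟨i, rfl⟩, rfl⟩
    exact strip_mem_outside σ n (hmem i) (hgen i)
  · intro p hp
    obtain ⟨σ, _, ⟨i, rfl⟩, rfl⟩ := Set.mem_iUnion.1 hp
    by_cases h0 : 0 < cond σ (n + 1) n
    · obtain ⟨s, σ', e⟩ := step_iterate_strip σ n (hmem i) (hgen i)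
      refine ⟨_, h0, s, _, Set.mem_iUnion.2 ⟨σ', _, ⟨i + 1, rfl⟩, rfl⟩, ?_⟩
      rw [e]
      simp only [Function.iterate_succ_apply']
    -- The cell around the table itself is returned after zero billiard steps, so the point is first
    -- rotated into the facing corner of cell `1`, where one step is made.
    · obtain ⟨rfl, rfl⟩ : σ = false ∧ n = 0 := by
        cases σ <;> simp_all
      obtain ⟨s, j, e⟩ := exists_half_turn (hmem i) (hgen i)
      rw [← Function.iterate_add_apply] at e
      obtain ⟨s', σ', e'⟩ := step_iterate_strip true 0 (hmem (j + i)) (hgen (j + i))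
      refine ⟨1, one_pos, s + s', _, Set.mem_iUnion.2 ⟨σ', _, ⟨j + i + 1, rfl⟩, rfl⟩, ?_⟩
      have e0 : strip false 0 (hornMap^[i] x) = hornMap^[i] x := by simp [strip]
      simp only [e0]
      rw [e, step_iterate_rt_pow_mul (strip_mem_outside true 0 (hmem _) (hgen _))]
      simp only [cond_true, zero_add] at e'
      rw [e', pow_add, mul_assoc]
      simp only [Function.iterate_succ_apply']

/-- The copy of the table about `4 n` is invariant under the rotation of the cell, which has order
12. -/
theorem finiteOrbit_disc {n : ℕ} (hn : 0 < n) {x : ℂ} (hx : x ∈ table) (hg : Generic x) :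
    FiniteOrbit step (4 * n + x) := by
  have hlt : ∀ i k, ht k (rt ^ i * x) < 1 := fun i k =>
    lt_of_le_of_ne (rt_pow_mul_mem_table hx i k) (by simpa using (hg.rt_pow_mul i).ne_nat k 1)
  have hlt' : ∀ i, -1 < ht 2 (rt ^ i * x) := fun i => by
    have := hlt i 8
    rw [ht_add_six 2] at this
    linarith
  have hn' : (1 : ℝ) ≤ n := by exact_mod_cast hn
  refine finiteOrbit_of_return_mod
    (S := (fun i : ℕ => 4 * n + rt ^ i * x) '' (Finset.range 12))
    ((Finset.finite_toSet _).image _) ?_ ?_ _ ⟨0, by simp, by simp⟩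
  · rintro _ ⟨i, -, rfl⟩
    refine ⟨generic_add_four_mul (hg.rt_pow_mul i) n, fun h => ?_⟩
    have := h 2
    rw [ht_two_add_four_mul] at this
    linarith [hlt' i]
  · rintro _ ⟨i, -, rfl⟩
    refine ⟨n, hn, 6 * n + 11, 4 * n + rt ^ (i + 1) * x,
      ⟨(i + 1) % 12, by simpa using Nat.mod_lt _ (by norm_num), by simp only [rt_pow_mod]⟩, ?_⟩
    rw [pow_succ' rt i, mul_assoc rt]
    exact step_iterate_cell n (hg.rt_pow_mul i) (hlt' i) (hlt i 3)

theorem exists_between {r : ℝ} (h : ∀ q : ℚ, r ≠ q) : ∃ m : ℤ, -1 < r - 2 * m ∧ r - 2 * m < 1 := by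
  refine ⟨⌊(r + 1) / 2⌋, ?_, ?_⟩
  · refine lt_of_le_of_ne (by linarith [Int.floor_le ((r + 1) / 2)]) fun e => ?_
    apply h (2 * ⌊(r + 1) / 2⌋ - 1)
    push_cast; linarith
  · linarith [Int.lt_floor_add_one ((r + 1) / 2)]

theorem mem_horn_or_neg_mem_horn {x : ℂ} (hx : x ∉ table) (h2 : -1 < ht 2 x) (h2' : ht 2 x < 1)
    (h3 : -1 < ht 3 x) (h3' : ht 3 x < 1) : x ∈ Horn ∨ -x ∈ Horn := by
  obtain ⟨k, hk⟩ : ∃ k, 1 < ht k x := by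
    by_contra h
    exact hx fun k => not_lt.1 fun hk => h ⟨k, hk⟩
  have g10 : ht 10 x = -ht 4 x := ht_add_six 4 x
  have g11 : ht 11 x = -ht 5 x := ht_add_six 5 x
  have g6 : ht 6 x = -ht 0 x := ht_add_six 0 x
  have g7 : ht 7 x = -ht 1 x := ht_add_six 1 x
  have g8 : ht 8 x = -ht 2 x := ht_add_six 2 x
  have g9 : ht 9 x = -ht 3 x := ht_add_six 3 x
  rw [← ht_mod] at hk
  have hk12 : k % 12 < 12 := Nat.mod_lt _ (by norm_num)
  have pos : 1 < ht 10 x ∨ 1 < ht 11 x ∨ 1 < ht 0 x ∨ 1 < ht 1 x → x ∈ Horn :=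
    fun h => ⟨by linarith, h2', h⟩
  have neg : 1 < ht 4 x ∨ 1 < ht 5 x ∨ 1 < ht 6 x ∨ 1 < ht 7 x → -x ∈ Horn := by
    intro h
    refine ⟨by rw [ht_neg]; linarith, by rw [ht_neg]; linarith, ?_⟩
    rw [ht_neg, ht_neg, ht_neg, ht_neg, g10, g11, neg_neg, neg_neg, ← g6, ← g7]
    exact h
  generalize k % 12 = j at hk hk12
  interval_cases j
  · exact Or.inl (pos (Or.inr (Or.inr (Or.inl hk))))
  · exact Or.inl (pos (Or.inr (Or.inr (Or.inr hk))))
  · linarith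
  · linarith
  · exact Or.inr (neg (Or.inl hk))
  · exact Or.inr (neg (Or.inr (Or.inl hk)))
  · exact Or.inr (neg (Or.inr (Or.inr (Or.inl hk))))
  · exact Or.inr (neg (Or.inr (Or.inr (Or.inr hk))))
  · linarith
  · linarith
  · exact Or.inl (pos (Or.inl hk))
  · exact Or.inl (pos (Or.inr (Or.inl hk)))

/-! ### Almost every point is periodic -/

/-- The points of the strip on the right of the table have a finite orbit or come from a horn. -/
theorem finiteOrbit_or_strip {u : ℂ} (hu : Generic u) (h3 : -1 < ht 3 u) (h3' : ht 3 u < 1)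
    (h4 : ht 4 u < -1) : FiniteOrbit step u ∨
      ∃ (n : ℕ) (σ : Bool), ∃ x ∈ Horn, Generic x ∧ u = strip σ n x := by
  obtain ⟨n, hn, hn'⟩ := exists_between (hu.ne_nat 2)
  have hl := sqrt_three_gt
  have hs := sqrt_three_lt
  have hu2 : -1 < ht 2 u := by
    have := ht_rec 2 u
    simp only [Nat.reduceAdd] at this
    nlinarith
  have hn0 : 0 ≤ n := by
    have : (-1 : ℝ) < n := by linarith
    have : -1 < n := by exact_mod_cast this
    omega
  lift n to ℕ using hn0
  simp only [Int.cast_natCast] at hn hn'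
  obtain ⟨x, rfl⟩ : ∃ x, u = 4 * n + x := ⟨u - 4 * n, by ring⟩
  have hgx : Generic x := by
    have h := special_four.surd_mul n 0
    push_cast at h
    rw [zero_mul, add_zero] at h
    rw [show x = 4 * n + x - n * 4 by ring]
    exact hu.sub h
  rw [ht_two_add_four_mul] at hn hn'
  rw [ht_three_add_four_mul] at h3 h3'
  rcases n.eq_zero_or_pos with rfl | hnpos
  · refine Or.inr ⟨0, false, x, ⟨?_, by simpa using hn', Or.inl ?_⟩, hgx, rfl⟩
    · rw [ht_add_six 3]; linarith
    · rw [ht_add_six 4]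
      simp only [Nat.cast_zero, mul_zero, zero_add] at h4
      linarith
  by_cases hxt : x ∈ table
  · exact Or.inl (finiteOrbit_disc hnpos hxt hgx)
  · rcases mem_horn_or_neg_mem_horn hxt (by linarith) (by linarith) h3 h3' with h | h
    · exact Or.inr ⟨n, false, x, h, hgx, rfl⟩
    · refine Or.inr ⟨n - 1, true, -x, h, hgx.neg, ?_⟩
      rw [strip, cond_true, neg_neg, Nat.sub_add_cancel hnpos]

/-- A point that does not come to the strip in a point of the horn with an infinite orbit has a
finite orbit. -/
theorem finiteOrbit_or_wandering {p : ℂ} (hp : p ∈ Outside) : FiniteOrbit step p ∨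
    ∃ (s i n : ℕ) (σ : Bool), ∃ x ∈ Wandering,
      p = rt ^ s * (rt ^ 11 * strip σ n x + 2 * i * vert) := by
  obtain ⟨s, q, hq, hg, rfl⟩ := exists_wedge hp
  have hqO := Wedge.mem_outside hq hg
  obtain ⟨i, hi, hi'⟩ := exists_between (hg.ne_nat 2)
  have hi0 : 0 < i := by
    have : (0 : ℝ) < i := by linarith [hq.2]
    exact_mod_cast this
  lift i to ℕ using hi0.le
  have hi1 : (1 : ℝ) ≤ i := by exact_mod_cast hi0
  simp only [Int.cast_natCast] at hi hi'
  have htr := step_iterate_translate (m := i) hg hq.1 (by linarith) i le_rfl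
  obtain ⟨-, -, e2, e3⟩ := ht_vert
  obtain ⟨u, hu⟩ : ∃ u, u = rt * (q - 2 * i * vert) := ⟨_, rfl⟩
  have e11 : rt ^ 11 * rt = 1 := by rw [← pow_succ, rt_pow_twelve]
  have hqu : q = rt ^ 11 * u + 2 * i * vert := by
    rw [hu]; linear_combination -(q - 2 * i * vert) * e11
  have hgu : Generic u := by
    have := special_vert.surd_mul (2 * i) 0
    push_cast at this
    rw [zero_mul, add_zero] at this
    rw [hu]
    exact (hg.sub this).rt_mul
  obtain ⟨-, -, -, r3, r4, -⟩ := ht_rt_mul (q - 2 * i * vert)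
  have hv : ∀ k, ht k (q - 2 * i * vert) = ht k q - 2 * i * ht k vert := fun k => by
    rw [ht_sub, show (2 * i * vert : ℂ) = ((2 * i : ℝ) : ℂ) * vert by push_cast; rfl, ht_real_mul]
  have hu3 : ht 3 u = ht 2 q - 2 * i := by rw [hu, r3, hv, e2]; ring
  have hu4 : ht 4 u < -1 := by rw [hu, r4, hv, e3]; linarith [hq.1]
  have hred : FiniteOrbit step u → FiniteOrbit step (rt ^ s * q) := by
    intro h
    have hw : q - 2 * i * vert = rt ^ 11 * u := by rw [hqu]; ring
    have huO : u ∈ Outside := by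
      have := Outside.rt_pow_mul (step_iterate_mem hqO i) (11 * (6 * i) + 1)
      rwa [htr, add_comm, pow_add, mul_assoc, rt_pow_cancel, pow_one, ← hu] at this
    refine finiteOrbit_rt_pow_mul hqO (FiniteOrbit.of_iterate (k := i) ?_)
    rw [htr, hw, ← mul_assoc, ← pow_add]
    exact finiteOrbit_rt_pow_mul huO h
  rcases finiteOrbit_or_strip hgu (by linarith) (by linarith) hu4 with h | ⟨n, σ, x, hx, hgx, e⟩
  · exact Or.inl (hred h)
  by_cases hf : FiniteOrbit hornMap x
  · exact Or.inl (hred (e ▸ finiteOrbit_strip σ n hx hgx hf))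
  · exact Or.inr ⟨s, i, n, σ, x, ⟨hx, hgx, hf⟩, by rw [← e, ← hqu]⟩

theorem volume_motion_image_wandering (α β : ℂ) : volume ((fun x => α * x + β) '' Wandering) = 0 :=
  addHaar_image_eq_zero_of_differentiableOn_of_addHaar_eq_zero volume
    (((differentiable_id.const_mul α).add_const β).differentiableOn) volume_wandering

theorem ae_isPeriodic : ∀ᵐ p : ℂ, p ∉ table → IsPeriodic table p := by
  -- Each choice of parameters gives the image of a null set under an affine map, and there are
  -- countably many choices.
  have hcover : ∀ᵐ p : ℂ, ∀ (s i n : ℕ) (σ : Bool),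
      ¬∃ x ∈ Wandering, p = rt ^ s * (rt ^ 11 * strip σ n x + 2 * i * vert) := by
    simp only [ae_all_iff]
    intro s i n σ
    rw [ae_iff]
    refine measure_mono_null ?_ (volume_motion_image_wandering
      (rt ^ s * rt ^ 11 * cond σ (-1) 1)
      (rt ^ s * (rt ^ 11 * (4 * cond σ (n + 1 : ℂ) n) + 2 * i * vert)))
    intro p hp
    simp only [not_not, Set.mem_ofPred_eq] at hp
    obtain ⟨x, hx, rfl⟩ := hp
    refine ⟨x, hx, ?_⟩
    cases σ <;> simp [strip] <;> ring
  filter_upwards [ae_generic, hcover] with p hg hp hpt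
  have hO : p ∈ Outside := ⟨hg, hpt⟩
  rcases finiteOrbit_or_wandering hO with h | ⟨s, i, n, σ, h⟩
  · exact isPeriodic_of_finiteOrbit hO h
  · exact absurd h (hp s i n σ)

/-! ### Transport to an arbitrary regular dodecagon -/

theorem exp_eq_rt_pow (k : ℕ) :
    Complex.exp (2 * Real.pi * Complex.I * (k : ℕ) / 12) = rt ^ k := by
  have h : rt = Complex.exp ((Real.pi / 6 : ℝ) * Complex.I) := by
    rw [Complex.exp_mul_I, ← Complex.ofReal_cos, ← Complex.ofReal_sin, Real.cos_pi_div_six,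
      Real.sin_pi_div_six]
    apply Complex.ext <;> simp [rt]
  rw [h, ← Complex.exp_nat_mul]
  congr 1
  push_cast; ring

theorem vert_ne_zero : vert ≠ 0 := by
  intro h
  have := congrArg Complex.im h
  simp [vert] at this

theorem regularDodecagon_eq_image (c a : ℂ) :
    regularDodecagon c a = (fun z => a / vert * z + c) '' table := by
  have e : (fun z => a / vert * z + c) =
      ((LinearMap.mulLeft ℝ (a / vert)).toAffineMap + AffineMap.const ℝ ℂ c : ℂ →ᵃ[ℝ] ℂ) := by
    ext z; simp
  rw [table_eq_convexHull, e, AffineMap.image_convexHull, ← Set.range_comp, regularDodecagon]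
  congr 2
  ext1 k
  rw [exp_eq_rt_pow, Function.comp_apply, ← e]
  have := vert_ne_zero
  field_simp
  ring

/-- A complex similarity multiplies oriented areas by `|u|² > 0`, so left sides are preserved. -/
theorem IsRightTangencyPoint.image {γ : Set ℂ} {p v u c : ℂ} (hu : u ≠ 0)
    (h : IsRightTangencyPoint γ p v) :
    IsRightTangencyPoint ((fun z => u * z + c) '' γ) (u * p + c) (u * v + c) := by
  refine ⟨⟨v, h.1, rfl⟩, ?_⟩
  rintro _ ⟨w, hw, rfl⟩ hne
  have key := h.2 w hw (fun e => hne (by rw [e]))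
  have e : cross (u * v + c - (u * p + c)) (u * w + c - (u * p + c)) =
      Complex.normSq u * cross (v - p) (w - p) := by
    simp only [cross, Complex.add_re, Complex.add_im, Complex.sub_re, Complex.sub_im,
      Complex.mul_re, Complex.mul_im, Complex.normSq_apply]
    ring
  simp only [e]
  exact mul_pos (Complex.normSq_pos.2 hu) key

theorem mem_iter_image {γ : Set ℂ} {u c : ℂ} (hu : u ≠ 0) (n : ℕ) {p q : ℂ}
    (h : q ∈ iter (outerBilliard γ) n p) :
    u * q + c ∈ iter (outerBilliard ((fun z => u * z + c) '' γ)) n (u * p + c) := by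
  induction n generalizing q with
  | zero =>
    rw [iter, Part.mem_some_iff] at h ⊢
    rw [h]
  | succ n ih =>
    rw [iter, Part.mem_bind_iff] at h
    obtain ⟨r, hr, hq⟩ := h
    refine Part.mem_bind (ih hr) ?_
    rw [mem_outerBilliard] at hq ⊢
    obtain ⟨hrγ, v, hv, rfl⟩ := hq
    refine ⟨?_, _, hv.image hu, by ring⟩
    rintro ⟨r', hr', e⟩
    have : r' = r := mul_left_cancel₀ hu (add_right_cancel e)
    exact hrγ (this ▸ hr')

theorem IsPeriodic.image {γ : Set ℂ} {u c p : ℂ} (hu : u ≠ 0) (h : IsPeriodic γ p) :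
    IsPeriodic ((fun z => u * z + c) '' γ) (u * p + c) := by
  obtain ⟨n, hn, h⟩ := h
  exact ⟨n, hn, mem_iter_image hu n h⟩

end OuterBilliard

theorem mainTheorem2 (c a : ℂ) (ha : a ≠ 0) :
    ∀ᵐ p ∂(MeasureTheory.volume.restrict (OuterBilliard.regularDodecagon c a)ᶜ),
      OuterBilliard.IsPeriodic (OuterBilliard.regularDodecagon c a) p := by
  have hu : a / OuterBilliard.vert ≠ 0 := div_ne_zero ha OuterBilliard.vert_ne_zero
  have hclosed : IsClosed (OuterBilliard.regularDodecagon c a) :=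
    ((Set.finite_range _).isCompact_convexHull ℝ).isClosed
  rw [MeasureTheory.ae_restrict_iff' hclosed.measurableSet.compl,
    OuterBilliard.regularDodecagon_eq_image]
  generalize a / OuterBilliard.vert = u at hu
  have h := OuterBilliard.ae_isPeriodic
  rw [MeasureTheory.ae_iff] at h ⊢
  refine MeasureTheory.measure_mono_null ?_
    (MeasureTheory.addHaar_image_eq_zero_of_differentiableOn_of_addHaar_eq_zero
      MeasureTheory.volume (f := fun z : ℂ => u * z + c)
      ((differentiable_id.const_mul u).add_const c).differentiableOn h)
  intro p hp
  have e : u * (u⁻¹ * (p - c)) + c = p := by field_simp; ring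
  refine ⟨u⁻¹ * (p - c), fun hq => hp fun hpt => ?_, e⟩
  have := OuterBilliard.IsPeriodic.image (c := c) hu (hq fun hmem => hpt ⟨_, hmem, e⟩)
  rwa [e] at this
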